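/- **Setting.** Fix a first-order signature whose only predicate is equality $\approx$, and an infinite set of variables. A literal is $s\approx t$ or $s\not\approx t$ ($s\,\#\,t$ stands for either; the two sides are unordered); $\mathrm{comp}$ is complement; a clause is a finite multiset of literals; $\bot$ also denotes the empty clause. A closure $C\cdot\sigma$ is a clause with a substitution $\sigma$ such that $C\sigma$ is ground. Most general unifiers are idempotent and introduce no fresh variables. Let $\prec_T$ be a desired term ordering: a well-founded rewrite ordering (transitive, closed under contexts and substitutions), total on ground terms, with only finitely many ground terms below each ground term. A literal $s\approx t$ is compared as the multiset $\{s,t\}$ and $s\not\approx t$ as $\{s,s,t,t\}$; clauses are compared by the multiset extension; $L\prec_T\beta$ and $C\prec_T\beta$ mean that all terms occurring as sides are $\prec_T\beta$. **Trails.** A trail $\Gamma$ is a sequence of annotated ground literals $L\sigma^{\,i:(L\vee C)\cdot\sigma}$ with level $i$. A ground literal $L$ is true (false) in $\Gamma$ if $\Gamma\models L$ ($\Gamma\models\mathrm{comp}(L)$), defined if it is true or false, undefined otherwise. For a ground term $\beta$ it is $\beta$-true ($\beta$-false) if moreover $L\prec_T\beta$; it is $\beta$-undefined if $\beta\prec_T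 L$ or it is undefined, and $\beta$-defined otherwise. A ground clause is $\beta$-true if some literal is, $\beta$-false if all literals are, $\beta$-undefined if neither holds. $\mathrm{conv}(\Gamma)$ is a convergent ground rewrite system, oriented by $\prec_T$ and equivalent to the positive equations in $\Gamma$. A substitution is irreducible if every $x\sigma\neq x$ is. A core of $L$ is a minimal subsequence of $\Gamma$ in which $L$ is defined; the defining literal $\max_\Gamma(L)$ is the rightmost literal of a core whose rightmost literal is as far left as possible (there is none if the only core is empty). The level of a defined $L$ is its annotation if $L\in\Gamma$, else the level of its defining literal, else $0$; the level of a clause is the maximum over its literals ($0$ for the empty clause). A trail literal is a decision literal if its level is one more than that of its predecessor in the trail (than $0$ if it is the first). The ordering $\prec_{\Gamma^*}$ on ground literals, extended to clauses as multisets, is as follows: $\beta$-defined literals of level $0$ come first, ordered by $\prec_T$; then the $\beta$-defined literals of positive level, in the trail order of their defining literals, where for the same defining literal $K$ the order is $K$, then $\mathrm{comp}(K)$, then all others by $\prec_T$; then the $\beta$-undefined literals, ordered by $\prec_T$. **Rewriting.** From variable-disjoint (after renaming) closures $(l_1\approx r_1\vee C_1)\cdot\sigma_1$ and $(l_2\,\#\,r_2\vee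 C_2)\cdot\sigma_2$ with $r_1\sigma_1\prec_T l_1\sigma_1=(l_2\,\#\,r_2)\sigma_2|_p$, a rewrite inference yields $\bigl((l_2\,\#\,r_2)\delta[r_1]_p\,\mu\vee C_1\mu\vee C_2\delta\mu\bigr)\cdot\sigma_1\sigma_2\rho$ with distinguished literal $(l_2\,\#\,r_2)\delta[r_1]_p\,\mu$. Here $\mu$ is the mgu of $(l_2\,\#\,r_2)\delta|_p$ and $l_1$; $\delta$ and $\rho$ are the identity if $p$ is a position of $l_2\,\#\,r_2$, and otherwise $(l_2\,\#\,r_2)\delta$ is the most general instance having position $p$, with fresh variables, and $(l_2\,\#\,r_2)\delta\sigma_2\rho=(l_2\,\#\,r_2)\sigma_2$. A reduction chain from $\Gamma$ is a finite sequence of closures with distinguished literals, each an annotation of $\Gamma$ or the result of a rewrite inference from earlier members. A reduction chain application from $\Gamma$ to an annotated literal $L\delta^{\,o:(L\vee C)\cdot\delta}$ is a minimal reduction chain from $\Gamma,L\delta^{\,o:(L\vee C)\cdot\delta}$ whose last distinguished ground literal is the $\mathrm{conv}(\Gamma)$-normal form of $L\delta$. A refutation from $\Gamma$ and an annotated literal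 that is $\beta$-false in $\Gamma$ is a minimal reduction chain from $\Gamma$ extended by that literal, with last distinguished ground literal of the form $s\not\approx s$. **Rules**, on states $(\Gamma;N;U;\beta;k;D)$, where $D$ is $\top$, $\bot$ or a closure: - *Propagate* ($D=\top$): choose $C_0\vee C_1\vee L\in N\cup U$ and an irreducible (by $\mathrm{conv}(\Gamma)$) grounding $\sigma$ with $\Gamma\models\neg C_0\sigma$, all literals of $C_1\sigma$ equal to $L\sigma$, $\mu$ the mgu of $L$ and the literals of $C_1$, $L\sigma$ $\beta$-undefined, $(C_0\vee L)\mu\sigma\prec_T\beta$, and a reduction chain application from $\Gamma$ to $L\sigma^{\,k:(L\vee C_0)\mu\cdot\sigma}$ with last member $(L_m\vee C_m)\cdot\sigma_m$. Append $L_m\sigma_m^{\,k:(L_m\vee C_m)\cdot\sigma_m}$ to $\Gamma$. - *Decide* ($D=\top$): choose $C_0\vee L\in N\cup U$ and an irreducible grounding $\sigma$ with $C_0\sigma$ $\beta$-undefined or $\beta$-true, $L\sigma$ $\beta$-undefined, $(C_0\vee L)\sigma\prec_T\beta$, and a reduction chain application from $\Gamma$ to $L\sigma^{\,k+1:(L\vee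 C_0)\cdot\sigma}$ with last member $(L_m\vee C_m)\cdot\sigma_m$. Append $L_m\sigma_m^{\,k+1:(L_m\vee\mathrm{comp}(L_m))\cdot\sigma_m}$ and set $k:=k+1$. - *Conflict* ($D=\top$): choose $D'\in N\cup U$ and an irreducible grounding $\sigma$ with $D'\sigma$ $\beta$-false in $\Gamma$. Set $D:=\bot$ if $D'\sigma$ has level $0$, and $D:=D'\cdot\sigma$ otherwise. - *Skip*: if $\Gamma=\Gamma',K,L$ and $D=D'\cdot\sigma$ with $D'\sigma$ $\beta$-false in $\Gamma',K$, remove $L$ and set $k$ to the level of $K$. - *Explore-Refutation*: if $D=(D'\vee L)\cdot\sigma$, $L\sigma$ is strictly $\prec_{\Gamma^*}$-maximal in $(D'\vee L)\sigma$, and the last literal of $\Gamma$ is the defining literal of $L\sigma$, take a member $E\cdot\tau$ of a refutation from $\Gamma$ and $L\sigma$ (annotated by $(D'\vee L)\cdot\sigma$) such that $E\tau\prec_{\Gamma^*}(D'\vee L)\sigma$ and $E\tau$ is $\beta$-false in $\Gamma$. Set $D:=E\cdot\tau$. - *Factorize*: $(D'\vee L\vee L')\cdot\sigma$ becomes $(D'\vee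 L)\mu\cdot\sigma$ if $L\sigma=L'\sigma$ and $\mu$ is the mgu of $L,L'$. - *Equality-Resolution*: $(D'\vee s\not\approx s')\cdot\sigma$ becomes $D'\mu\cdot\sigma$ if $s\sigma=s'\sigma$ and $\mu$ is the mgu of $s,s'$. - *Backtrack*: if $D=(D'\vee L)\cdot\sigma$, $D'\sigma$ has level $<k$, and $\Gamma_0,K$ is the shortest prefix of $\Gamma$ such that for some grounding $\tau$ the clause $(D'\vee L)\tau$ is $\beta$-false in $\Gamma_0,K$ but not in $\Gamma_0$, then set $\Gamma:=\Gamma_0$, $U:=U\cup\{D'\vee L\}$, $D:=\top$, and $k:=j-i$, where $j$ is the level of $K$ and $i=1$ if $K$ is a decision literal, $i=0$ otherwise. - *Grow* ($D=\top$): set $\Gamma:=\epsilon$, $k:=0$ and $\beta:=\beta'$ for a ground term $\beta'$ with $\beta\prec_T\beta'$. **Runs.** A run is a finite or infinite sequence of rule applications starting from $(\epsilon;N;\emptyset;\beta;0;\top)$. It is regular if 1. Conflict and Factorize have precedence over all other rules; 2. if $k=0$, Propagate has precedence over Decide; 3. if Propagate could add a literal $L$ with an annotation clause in $N\cup U$,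 then Decide does not add $\mathrm{comp}(L)$ in that state; 4. between a Conflict and the following Backtrack, Skip is applied at least once, unless that Conflict was applied immediately after Decide; 5. if Conflict is applied immediately after Decide, then the following Backtrack is only applied in a state whose conflict closure $D\cdot\sigma$ has a literal $L\in D$ with $L\sigma=\mathrm{comp}(L')$, where $L'$ is the last trail literal. **Lemma (termination).** Let $N$ be a (possibly infinite) set of clauses and $\beta$ a ground term. Then every regular run from $(\epsilon;N;\emptyset;\beta;0;\top)$ that never uses Grow terminates, that is, it is finite. Moreover, if such a run ends with status $\top$ and cannot be continued, without Grow, to a longer regular run, then no rule other than Grow is applicable to its last state. -/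

import Mathlib

universe u v w

namespace SCLEQ

section Basics

variable {L : FirstOrder.Language.{u, v}} {V : Type w}

/-! ### Terms, substitutions, positions -/

/-- The set of variables of a term. -/
def tvars : L.Term V → Set V
  | .var x => {x}
  | .func _ ts => ⋃ i, tvars (ts i)

/-- A term is ground if it contains no variable. -/
def TGround (t : L.Term V) : Prop := tvars t = ∅

/-- Substitutions are total maps from variables to terms. -/
abbrev Subst (L : FirstOrder.Language.{u, v}) (V : Type w) := V → L.Term V

/-- The composition "first `σ`, then `τ`". -/
def Subst.comp (σ τ : Subst L V) : Subst L V := fun x => (σ x).subst τ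

/-- The subterm `t|_p`, if `p` is a position of `t` (argument places are counted from `0`). -/
def subtermAt : L.Term V → List ℕ → Option (L.Term V)
  | t, [] => some t
  | .var _, _ :: _ => none
  | @FirstOrder.Language.Term.func _ _ n _ ts, i :: p =>
      if h : i < n then subtermAt (ts ⟨i, h⟩) p else none

/-- The replacement `t[s]_p` (it is `t` if `p` is not a position of `t`). -/
def replaceAt : L.Term V → List ℕ → L.Term V → L.Term V
  | _, [], s => s
  | .var x, _ :: _, _ => .var x
  | @FirstOrder.Language.Term.func _ _ n f ts, i :: p, s =>
      if h : i < n then .func f (Function.update ts ⟨i, h⟩ (replaceAt (ts ⟨i, h⟩) p s))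
      else .func f ts

/-! ### Literals and clauses -/

/-- An equational literal: `s ≈ t` if `pos = true`, and `s ≉ t` if `pos = false`. As usual,
equations are unordered, so `s ≈ t` and `t ≈ s` are the same literal. -/
@[ext]
structure Literal (L : FirstOrder.Language.{u, v}) (V : Type w) where
  pos : Bool
  eqn : Sym2 (L.Term V)

/-- Clauses are finite multisets of literals. -/
abbrev Clause (L : FirstOrder.Language.{u, v}) (V : Type w) := Multiset (Literal L V)

/-- The complement of a literal. -/
def Literal.comp (K : Literal L V) : Literal L V := ⟨!K.pos, K.eqn⟩

def Literal.subst (K : Literal L V) (σ : Subst L V) : Literal L V :=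
  ⟨K.pos, K.eqn.map fun t => t.subst σ⟩

def Literal.vars (K : Literal L V) : Set V := {x | ∃ t ∈ K.eqn, x ∈ tvars t}

def Literal.Ground (K : Literal L V) : Prop := K.vars = ∅

def Clause.subst (C : Clause L V) (σ : Subst L V) : Clause L V :=
  Multiset.map (fun K : Literal L V => K.subst σ) C

def Clause.vars (C : Clause L V) : Set V := {x | ∃ K ∈ C, x ∈ K.vars}

def Clause.Ground (C : Clause L V) : Prop := Clause.vars C = ∅

/-! ### Most general unifiers -/

def Unifies (θ : Subst L V) (E : Set (L.Term V × L.Term V)) : Prop :=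
  ∀ e ∈ E, e.1.subst θ = e.2.subst θ

/-- `μ` is an idempotent most general unifier of the equations `E` that uses no fresh variables. -/
structure IsMgu (E : Set (L.Term V × L.Term V)) (μ : Subst L V) : Prop where
  unifies : Unifies μ E
  most_general : ∀ θ, Unifies θ E → ∃ ρ, θ = Subst.comp μ ρ
  idempotent : Subst.comp μ μ = μ
  no_fresh : ∀ x, μ x ≠ .var x →
    (∃ e ∈ E, x ∈ tvars e.1 ∪ tvars e.2) ∧
      ∀ y ∈ tvars (μ x), ∃ e ∈ E, y ∈ tvars e.1 ∪ tvars e.2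

/-- `μ` is a most general unifier of the literal `K` and the literals in `S`. Since equations are
unordered, there can be several ways to match their sides; the one used is a way in which `σ`
unifies the literals (so that `σ` is an instance of `μ`). -/
def IsLitMgu (σ : Subst L V) (K : Literal L V) (S : Clause L V) (μ : Subst L V) : Prop :=
  ∃ (s t : L.Term V) (P : Multiset (L.Term V × L.Term V)),
    K = ⟨K.pos, s(s, t)⟩ ∧
    S = P.map (fun q => (⟨K.pos, s(q.1, q.2)⟩ : Literal L V)) ∧
    (∀ q ∈ P, q.1.subst σ = s.subst σ ∧ q.2.subst σ = t.subst σ) ∧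
    IsMgu {e | ∃ q ∈ P, e = (s, q.1) ∨ e = (t, q.2)} μ

/-! ### Orderings -/

/-- The multiset extension of a relation. -/
def MulLT {α : Type*} (r : α → α → Prop) (M N : Multiset α) : Prop :=
  ∃ X Y Z : Multiset α, Z ≠ 0 ∧ M = X + Y ∧ N = X + Z ∧ ∀ y ∈ Y, ∃ z ∈ Z, r y z

/-- A desired term ordering: a well-founded rewrite ordering that is total on ground terms and
such that only finitely many ground terms are below any ground term. -/
structure IsDesiredTermOrdering (lt : L.Term V → L.Term V → Prop) : Prop where
  wellFounded : WellFounded lt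
  trans : ∀ r s t, lt r s → lt s t → lt r t
  subst : ∀ s t (σ : Subst L V), lt s t → lt (s.subst σ) (t.subst σ)
  context : ∀ (t : L.Term V) (p : List ℕ) (s s' : L.Term V), (subtermAt t p).isSome →
    lt s s' → lt (replaceAt t p s) (replaceAt t p s')
  total : ∀ s t, TGround s → TGround t → s = t ∨ lt s t ∨ lt t s
  finite_below : ∀ t, TGround t → {s | TGround s ∧ lt s t}.Finite

/-- The multiset `{s, t}` for `s ≈ t` and `{s, s, t, t}` for `s ≉ t`. -/
def Literal.toMultiset (K : Literal L V) : Multiset (L.Term V) :=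
  if K.pos then K.eqn.toMultiset else K.eqn.toMultiset + K.eqn.toMultiset

/-- `K ≺_T H` for literals. -/
def LitLT (lt : L.Term V → L.Term V → Prop) (K H : Literal L V) : Prop :=
  MulLT lt K.toMultiset H.toMultiset

/-- `K ≺_T β` for a literal `K` and a term `β`. -/
def LitBelow (lt : L.Term V → L.Term V → Prop) (β : L.Term V) (K : Literal L V) : Prop :=
  MulLT lt K.toMultiset {β}

/-- `β ≺_T K` for a literal `K` and a term `β`. -/
def LitAbove (lt : L.Term V → L.Term V → Prop) (β : L.Term V) (K : Literal L V) : Prop :=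
  MulLT lt {β} K.toMultiset

/-- `C ≺_T β` for a clause `C` and a term `β`. -/
def ClauseBelow (lt : L.Term V → L.Term V → Prop) (β : L.Term V) (C : Clause L V) : Prop :=
  MulLT (MulLT lt) (Multiset.map Literal.toMultiset C) {{β}}

/-! ### Semantics of ground literals -/

/-- Truth of a literal in an `L`-structure under a valuation of the variables. -/
def Literal.Holds (K : Literal L V) (M : Type*) [L.Structure M] (val : V → M) : Prop :=
  K.pos = true ↔ (K.eqn.map fun t => t.realize val).IsDiag

/-- Semantic entailment; it is only used for ground literals. -/
def Entails (Γ : Set (Literal L V)) (K : Literal L V) : Prop :=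
  ∀ (M : Type (max u w)) [L.Structure M] (val : V → M),
    (∀ H ∈ Γ, H.Holds M val) → K.Holds M val

/-- `K` is defined in `Γ`: it is true or false in `Γ`. -/
def Defined (Γ : Set (Literal L V)) (K : Literal L V) : Prop :=
  Entails Γ K ∨ Entails Γ K.comp

def BTrue (lt : L.Term V → L.Term V → Prop) (β : L.Term V) (Γ : Set (Literal L V))
    (K : Literal L V) : Prop :=
  LitBelow lt β K ∧ Entails Γ K

def BFalse (lt : L.Term V → L.Term V → Prop) (β : L.Term V) (Γ : Set (Literal L V))
    (K : Literal L V) : Prop :=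
  LitBelow lt β K ∧ Entails Γ K.comp

def BUndef (lt : L.Term V → L.Term V → Prop) (β : L.Term V) (Γ : Set (Literal L V))
    (K : Literal L V) : Prop :=
  LitAbove lt β K ∨ ¬ Defined Γ K

/-- A clause is `β`-true if one of its literals is. -/
def ClauseBTrue (lt : L.Term V → L.Term V → Prop) (β : L.Term V) (Γ : Set (Literal L V))
    (C : Clause L V) : Prop :=
  ∃ K ∈ C, BTrue lt β Γ K

/-- A clause is `β`-false if all of its literals are. -/
def ClauseBFalse (lt : L.Term V → L.Term V → Prop) (β : L.Term V) (Γ : Set (Literal L V))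
    (C : Clause L V) : Prop :=
  ∀ K ∈ C, BFalse lt β Γ K

/-- A clause is `β`-undefined if it is neither `β`-true nor `β`-false. -/
def ClauseBUndef (lt : L.Term V → L.Term V → Prop) (β : L.Term V) (Γ : Set (Literal L V))
    (C : Clause L V) : Prop :=
  ¬ ClauseBTrue lt β Γ C ∧ ¬ ClauseBFalse lt β Γ C

/-! ### Rewriting -/

/-- One rewrite step with the term rewrite system `R`. -/
def Rewrites (R : Set (L.Term V × L.Term V)) (s t : L.Term V) : Prop :=
  ∃ e ∈ R, ∃ (p : List ℕ) (σ : Subst L V),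
    subtermAt s p = some (e.1.subst σ) ∧ t = replaceAt s p (e.2.subst σ)

def Irreducible (R : Set (L.Term V × L.Term V)) (t : L.Term V) : Prop :=
  ∀ t', ¬ Rewrites R t t'

/-- `t` is the `R`-normal form of `s`. -/
def IsNormalForm (R : Set (L.Term V × L.Term V)) (s t : L.Term V) : Prop :=
  Relation.ReflTransGen (Rewrites R) s t ∧ Irreducible R t

/-- The literal `H` results from `K` by normalizing both of its sides. -/
def IsLitNormalForm (R : Set (L.Term V × L.Term V)) (K H : Literal L V) : Prop :=
  ∃ s t s' t', K = ⟨K.pos, s(s, t)⟩ ∧ H = ⟨K.pos, s(s', t')⟩ ∧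
    IsNormalForm R s s' ∧ IsNormalForm R t t'

/-- A substitution is irreducible if all terms in its codomain are. -/
def IrreducibleSubst (R : Set (L.Term V × L.Term V)) (σ : Subst L V) : Prop :=
  ∀ x, σ x ≠ .var x → Irreducible R (σ x)

/-- `conv(Γ)`: the convergent ground rewrite system given by all ground equations that follow from
the positive equations in `Γ`, oriented by `≺_T`. Any convergent system that is oriented by `≺_T`
and equivalent to the positive equations in `Γ` has the same normal forms on ground terms, namely
the `≺_T`-least elements of the classes, and hence the same irreducible ground terms. -/
def conv (lt : L.Term V → L.Term V → Prop) (Γ : Set (Literal L V)) :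
    Set (L.Term V × L.Term V) :=
  {e | TGround e.1 ∧ TGround e.2 ∧ lt e.2 e.1 ∧
    Entails {K | K ∈ Γ ∧ K.pos = true} ⟨true, s(e.1, e.2)⟩}

/-! ### Trails -/

/-- An annotated ground literal `Kσ^{i:(K ∨ C)·σ}` with level `i`, `K = lead`, `C = rest`. -/
@[ext]
structure AnnLit (L : FirstOrder.Language.{u, v}) (V : Type w) where
  level : ℕ
  lead : Literal L V
  rest : Clause L V
  sub : Subst L V

/-- The ground literal itself. -/
def AnnLit.lit (a : AnnLit L V) : Literal L V := a.lead.subst a.sub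

/-- The clause of the annotation. -/
def AnnLit.clause (a : AnnLit L V) : Clause L V := a.lead ::ₘ a.rest

/-- Trails; the last element is the rightmost (newest) literal. -/
abbrev Trail (L : FirstOrder.Language.{u, v}) (V : Type w) := List (AnnLit L V)

def Trail.lits (Γ : Trail L V) : Set (Literal L V) := {K | ∃ a ∈ Γ, a.lit = K}

/-- The literals of the subsequence of `Γ` given by a set of indices. -/
def Trail.litsAt (Γ : Trail L V) (I : Finset (Fin (List.length Γ))) : Set (Literal L V) :=
  {K | ∃ i ∈ I, (List.get Γ i).lit = K}

/-- The subsequence given by `I` is a core of `K`: a minimal one in which `K` is defined. -/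
def IsCore (Γ : Trail L V) (K : Literal L V) (I : Finset (Fin (List.length Γ))) : Prop :=
  Defined (Trail.litsAt Γ I) K ∧ ∀ J, J ⊂ I → ¬ Defined (Trail.litsAt Γ J) K

/-- The `i`-th literal of `Γ` is the defining literal of `K`: it is the largest literal of a core,
and no core has a smaller largest literal. -/
def IsDefiningIndex (Γ : Trail L V) (K : Literal L V) (i : Fin (List.length Γ)) : Prop :=
  (∃ I, IsCore Γ K I ∧ i ∈ I ∧ ∀ j ∈ I, j ≤ i) ∧ ∀ J, IsCore Γ K J → ∃ j ∈ J, i ≤ j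

open Classical in
/-- The level of a defined ground literal. -/
noncomputable def litLevel (Γ : Trail L V) (K : Literal L V) : ℕ :=
  if h : ∃ a ∈ Γ, a.lit = K then h.choose.level
  else if h : ∃ i, IsDefiningIndex Γ K i then (List.get Γ h.choose).level
  else 0

/-- The level of a ground clause: the maximal level of its literals (`0` for the empty clause). -/
noncomputable def clauseLevel (Γ : Trail L V) (C : Clause L V) : ℕ :=
  (Multiset.map (litLevel Γ) C).sup

/-- The level of the last literal of a trail (`0` for the empty trail). -/
def lastLevel (Γ : Trail L V) : ℕ := ((List.getLast? Γ).map AnnLit.level).getD 0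

/-- `a` is a decision literal after the trail prefix `Γ`: its level exceeds that of its
predecessor by one. -/
def IsDecision (Γ : Trail L V) (a : AnnLit L V) : Prop := a.level = lastLevel Γ + 1

/-! ### The trail induced ordering -/

/-- `β`-defined literals `M_{i,j}` outside `Γ ∪ comp(Γ)` whose defining literal is the `i`-th one. -/
def IsMLit (lt : L.Term V → L.Term V → Prop) (β : L.Term V) (Γ : Trail L V)
    (i : Fin (List.length Γ)) (K : Literal L V) : Prop :=
  ¬ BUndef lt β (Trail.lits Γ) K ∧ K ∉ Trail.lits Γ ∧ K.comp ∉ Trail.lits Γ ∧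
    IsDefiningIndex Γ K i

/-- The clauses of the trail induced ordering `≺_{Γ*}` on ground literals. -/
inductive TrailLTRules (lt : L.Term V → L.Term V → Prop) (β : L.Term V) (Γ : Trail L V) :
    Literal L V → Literal L V → Prop
  | m_m_lt {i k : Fin (List.length Γ)} {K H : Literal L V} (hK : IsMLit lt β Γ i K)
      (hH : IsMLit lt β Γ k H) (lK : 0 < litLevel Γ K) (lH : 0 < litLevel Γ H) (h : i < k) :
      TrailLTRules lt β Γ K H
  | m_m_eq {i : Fin (List.length Γ)} {K H : Literal L V} (hK : IsMLit lt β Γ i K)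
      (hH : IsMLit lt β Γ i H) (lK : 0 < litLevel Γ K) (lH : 0 < litLevel Γ H)
      (h : LitLT lt K H) : TrailLTRules lt β Γ K H
  | l_l {i j : Fin (List.length Γ)} (li : 0 < litLevel Γ (List.get Γ i).lit)
      (lj : 0 < litLevel Γ (List.get Γ j).lit) (h : i < j) :
      TrailLTRules lt β Γ (List.get Γ i).lit (List.get Γ j).lit
  | c_l {i j : Fin (List.length Γ)} (li : 0 < litLevel Γ (List.get Γ i).lit.comp)
      (lj : 0 < litLevel Γ (List.get Γ j).lit) (h : i < j) :
      TrailLTRules lt β Γ (List.get Γ i).lit.comp (List.get Γ j).lit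
  | l_c {i j : Fin (List.length Γ)} (li : 0 < litLevel Γ (List.get Γ i).lit)
      (lj : 0 < litLevel Γ (List.get Γ j).lit.comp) (h : i ≤ j) :
      TrailLTRules lt β Γ (List.get Γ i).lit (List.get Γ j).lit.comp
  | c_c {i j : Fin (List.length Γ)} (li : 0 < litLevel Γ (List.get Γ i).lit.comp)
      (lj : 0 < litLevel Γ (List.get Γ j).lit.comp) (h : i < j) :
      TrailLTRules lt β Γ (List.get Γ i).lit.comp (List.get Γ j).lit.comp
  | l_m {i k : Fin (List.length Γ)} {H : Literal L V} (hH : IsMLit lt β Γ k H)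
      (li : 0 < litLevel Γ (List.get Γ i).lit) (lH : 0 < litLevel Γ H) (h : i ≤ k) :
      TrailLTRules lt β Γ (List.get Γ i).lit H
  | c_m {i k : Fin (List.length Γ)} {H : Literal L V} (hH : IsMLit lt β Γ k H)
      (li : 0 < litLevel Γ (List.get Γ i).lit.comp) (lH : 0 < litLevel Γ H) (h : i ≤ k) :
      TrailLTRules lt β Γ (List.get Γ i).lit.comp H
  | m_l {i k : Fin (List.length Γ)} {K : Literal L V} (hK : IsMLit lt β Γ k K)
      (lK : 0 < litLevel Γ K) (li : 0 < litLevel Γ (List.get Γ i).lit) (h : k < i) :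
      TrailLTRules lt β Γ K (List.get Γ i).lit
  | m_c {i k : Fin (List.length Γ)} {K : Literal L V} (hK : IsMLit lt β Γ k K)
      (lK : 0 < litLevel Γ K) (li : 0 < litLevel Γ (List.get Γ i).lit.comp) (h : k < i) :
      TrailLTRules lt β Γ K (List.get Γ i).lit.comp
  | zero_zero {K H : Literal L V} (hK : ¬ BUndef lt β (Trail.lits Γ) K)
      (hH : ¬ BUndef lt β (Trail.lits Γ) H) (lK : litLevel Γ K = 0) (lH : litLevel Γ H = 0)
      (h : LitLT lt K H) : TrailLTRules lt β Γ K H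
  | zero_pos {K H : Literal L V} (hK : ¬ BUndef lt β (Trail.lits Γ) K)
      (hH : ¬ BUndef lt β (Trail.lits Γ) H) (lK : litLevel Γ K = 0) (lH : 0 < litLevel Γ H) :
      TrailLTRules lt β Γ K H
  | undef_undef {K H : Literal L V} (hK : BUndef lt β (Trail.lits Γ) K)
      (hH : BUndef lt β (Trail.lits Γ) H) (h : LitLT lt K H) : TrailLTRules lt β Γ K H
  | def_undef {K H : Literal L V} (hK : ¬ BUndef lt β (Trail.lits Γ) K)
      (hH : BUndef lt β (Trail.lits Γ) H) : TrailLTRules lt β Γ K H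

/-- The trail induced ordering `≺_{Γ*}` on ground literals. -/
def TrailLT (lt : L.Term V → L.Term V → Prop) (β : L.Term V) (Γ : Trail L V)
    (K H : Literal L V) : Prop :=
  K.Ground ∧ H.Ground ∧ TrailLTRules lt β Γ K H

/-! ### Rewrite inferences, reduction chains, refutations -/

/-- Rewrite steps `(K·σ, (K ∨ C)·σ, R, S, p)` with `K = lead`, `C = rest`: without premises
(`leaf`), or with the premises `R`, `S` and a position (`node`). -/
inductive RewriteStep (L : FirstOrder.Language.{u, v}) (V : Type w)
  | leaf (lead : Literal L V) (rest : Clause L V) (sub : Subst L V)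
  | node (lead : Literal L V) (rest : Clause L V) (sub : Subst L V)
      (R S : RewriteStep L V) (p : List ℕ)

/-- The rewrite literal. -/
def RewriteStep.lead : RewriteStep L V → Literal L V
  | .leaf K _ _ => K
  | .node K _ _ _ _ _ => K

def RewriteStep.rest : RewriteStep L V → Clause L V
  | .leaf _ C _ => C
  | .node _ C _ _ _ _ => C

def RewriteStep.sub : RewriteStep L V → Subst L V
  | .leaf _ _ σ => σ
  | .node _ _ σ _ _ _ => σ

def RewriteStep.clause (I : RewriteStep L V) : Clause L V := I.lead ::ₘ I.rest

/-- The instance `l₂δ` of `l₂` used for rewriting `l₂σ₂` at `p`: `δ` is the identity if `p` is a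
position of `l₂`; otherwise `l₂δ` is the most general instance of `l₂` that has the position `p` and
has `l₂σ₂` as an instance, and `δ` introduces only fresh variables (not in `X`). -/
def IsExpansion (l₂ : L.Term V) (p : List ℕ) (σ₂ : Subst L V) (X : Set V) (δ : Subst L V) : Prop :=
  ((subtermAt l₂ p).isSome ∧ δ = fun x => .var x) ∨
  (subtermAt l₂ p = none ∧
    (subtermAt (l₂.subst δ) p).isSome ∧
    (∃ ρ : Subst L V, (l₂.subst δ).subst ρ = l₂.subst σ₂) ∧
    (∀ δ' : Subst L V, (subtermAt (l₂.subst δ') p).isSome →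
      (∃ ρ' : Subst L V, (l₂.subst δ').subst ρ' = l₂.subst σ₂) →
      ∃ θ : Subst L V, l₂.subst δ' = (l₂.subst δ).subst θ) ∧
    (∀ x, δ x ≠ .var x → x ∈ tvars l₂ ∧ Disjoint (tvars (δ x)) X))

/-- Rewrite inference from variable disjoint closures `(l₁ ≈ r₁ ∨ C₁)·σ₁` and `(K₂ ∨ C₂)·σ₂`, where
`K₂` is `l₂ # r₂` up to the order of its sides and is rewritten below `l₂` at position `p`. The
result is `((l₂ # r₂)δ[r₁]_p μ ∨ C₁μ ∨ C₂δμ)·σ₃`, where `μ` is a most general unifier of `l₂δ|_p` and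
`l₁`, and `σ₃` combines `σ₁`, `σ₂` and the matcher from `l₂δ` to `l₂σ₂`. -/
def IsRewriteResult (lt : L.Term V → L.Term V → Prop)
    (K₁ : Literal L V) (C₁ : Clause L V) (σ₁ : Subst L V)
    (K₂ : Literal L V) (C₂ : Clause L V) (σ₂ : Subst L V) (p : List ℕ)
    (K₃ : Literal L V) (C₃ : Clause L V) (σ₃ : Subst L V) : Prop :=
  Disjoint (Clause.vars (K₁ ::ₘ C₁)) (Clause.vars (K₂ ::ₘ C₂)) ∧
  ∃ (l₁ r₁ l₂ r₂ u : L.Term V) (δ μ : Subst L V),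
    K₁ = ⟨true, s(l₁, r₁)⟩ ∧ K₂ = ⟨K₂.pos, s(l₂, r₂)⟩ ∧
    lt (r₁.subst σ₁) (l₁.subst σ₁) ∧
    subtermAt (l₂.subst σ₂) p = some (l₁.subst σ₁) ∧
    IsExpansion l₂ p σ₂ (Clause.vars (K₁ ::ₘ C₁) ∪ Clause.vars (K₂ ::ₘ C₂)) δ ∧
    subtermAt (l₂.subst δ) p = some u ∧
    IsMgu {(u, l₁)} μ ∧
    K₃ = Literal.subst ⟨K₂.pos, s(replaceAt (l₂.subst δ) p r₁, r₂.subst δ)⟩ μ ∧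
    C₃ = Clause.subst C₁ μ + Clause.subst (Clause.subst C₂ δ) μ ∧
    (∀ x ∈ Clause.vars (K₁ ::ₘ C₁), σ₃ x = σ₁ x) ∧
    (∀ x ∈ Clause.vars (K₂ ::ₘ C₂), σ₃ x = σ₂ x ∧ (δ x).subst σ₃ = σ₂ x)

/-- The renaming substitution of a permutation of the variables. -/
def renameSubst (L : FirstOrder.Language.{u, v}) {V : Type w} (e : V ≃ V) : Subst L V := fun x => .var (e x)

/-- `I` is the result of a rewrite inference from `R` and `S` at `p`. The clauses of the two
premises are first made variable disjoint by renaming; a closure `C·σ` is renamed by `e` to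
`(C e)·(e⁻¹ σ)`. -/
def IsRewriteInference (lt : L.Term V → L.Term V → Prop) (R S : RewriteStep L V) (p : List ℕ)
    (I : RewriteStep L V) : Prop :=
  ∃ e₁ e₂ : V ≃ V,
    IsRewriteResult lt
      (R.lead.subst (renameSubst L e₁)) (Clause.subst R.rest (renameSubst L e₁))
      (fun x => R.sub (e₁.symm x))
      (S.lead.subst (renameSubst L e₂)) (Clause.subst S.rest (renameSubst L e₂))
      (fun x => S.sub (e₂.symm x))
      p I.lead I.rest I.sub

/-- A reduction chain from `Γ`: every step is the closure of a literal of `Γ`, or the result of a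
rewrite inference from two earlier steps. -/
def IsReductionChain (lt : L.Term V → L.Term V → Prop) (Γ : Trail L V)
    (P : List (RewriteStep L V)) : Prop :=
  ∀ i : Fin P.length,
    (∃ a ∈ Γ, P.get i = .leaf a.lead a.rest a.sub) ∨
    ∃ j k : Fin P.length, j < i ∧ k < i ∧ ∃ p K C σ,
      P.get i = .node K C σ (P.get j) (P.get k) p ∧
      IsRewriteInference lt (P.get j) (P.get k) p (P.get i)

/-- A reduction chain from `Γ, a` that ends in the `conv(Γ)`-normal form of the literal of `a`. -/
def IsPreReductionChainApp (lt : L.Term V → L.Term V → Prop) (Γ : Trail L V) (a : AnnLit L V)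
    (P : List (RewriteStep L V)) : Prop :=
  IsReductionChain lt (Γ ++ [a]) P ∧
  ∃ I, P.getLast? = some I ∧
    IsLitNormalForm (conv lt (Trail.lits Γ)) a.lit (I.lead.subst I.sub)

/-- A (minimal) reduction chain application from `Γ` to the annotated literal `a`. -/
def IsReductionChainApp (lt : L.Term V → L.Term V → Prop) (Γ : Trail L V) (a : AnnLit L V)
    (P : List (RewriteStep L V)) : Prop :=
  IsPreReductionChainApp lt Γ a P ∧
  ∀ i < P.length, ¬ IsPreReductionChainApp lt Γ a (P.eraseIdx i)

/-- A reduction chain from `Γ, a` that ends in a literal `s ≉ s`. -/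
def IsPreRefutation (lt : L.Term V → L.Term V → Prop) (Γ : Trail L V) (a : AnnLit L V)
    (P : List (RewriteStep L V)) : Prop :=
  IsReductionChain lt (Γ ++ [a]) P ∧
  ∃ I s, P.getLast? = some I ∧ I.lead.subst I.sub = ⟨false, s(s, s)⟩

/-- A (minimal) refutation from `Γ` and the annotated literal `a`, which is `β`-false in `Γ`. -/
def IsRefutation (lt : L.Term V → L.Term V → Prop) (β : L.Term V) (Γ : Trail L V) (a : AnnLit L V)
    (P : List (RewriteStep L V)) : Prop :=
  BFalse lt β (Trail.lits Γ) a.lit ∧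
  IsPreRefutation lt Γ a P ∧
  ∀ i, i + 1 < P.length → ¬ IsPreRefutation lt Γ a (P.eraseIdx i)

/-! ### States and rules -/

/-- The last component of a state: `⊤`, `⊥`, or a closure `C·σ`. -/
inductive Status (L : FirstOrder.Language.{u, v}) (V : Type w)
  | top
  | bot
  | conflict (C : Clause L V) (σ : Subst L V)

/-- States `(Γ; N; U; β; k; D)`. -/
@[ext]
structure State (L : FirstOrder.Language.{u, v}) (V : Type w) where
  trail : Trail L V
  N : Set (Clause L V)
  U : Set (Clause L V)
  β : L.Term V
  k : ℕ
  status : Status L V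

/-- The initial state `(ε; N; ∅; β; 0; ⊤)`. -/
def initialState (N : Set (Clause L V)) (β : L.Term V) : State L V := ⟨[], N, ∅, β, 0, .top⟩

/-- The names of the rules. -/
inductive Rule
  | propagate
  | decide
  | conflict
  | skip
  | exploreRefutation
  | factorize
  | equalityResolution
  | backtrack
  | grow

/-- `S` turns into `T` by Propagate, which adds the annotated literal `a`. -/
def PropagateStep (lt : L.Term V → L.Term V → Prop) (S T : State L V) (a : AnnLit L V) : Prop :=
  S.status = .top ∧
  ∃ (C₀ C₁ : Clause L V) (K : Literal L V) (σ μ : Subst L V)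
    (P : List (RewriteStep L V)) (I : RewriteStep L V),
    (C₀ + C₁ + {K}) ∈ S.N ∪ S.U ∧
    Clause.Ground (Clause.subst (C₀ + C₁ + {K}) σ) ∧
    (∀ H ∈ Clause.subst C₀ σ, Entails (Trail.lits S.trail) H.comp) ∧
    (∀ H ∈ C₁, H.subst σ = K.subst σ) ∧
    IsLitMgu σ K C₁ μ ∧
    BUndef lt S.β (Trail.lits S.trail) (K.subst σ) ∧
    ClauseBelow lt S.β (Clause.subst (Clause.subst (C₀ + {K}) μ) σ) ∧
    IrreducibleSubst (conv lt (Trail.lits S.trail)) σ ∧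
    IsReductionChainApp lt S.trail ⟨S.k, K.subst μ, Clause.subst C₀ μ, σ⟩ P ∧
    P.getLast? = some I ∧
    a = ⟨S.k, I.lead, I.rest, I.sub⟩ ∧
    T = { S with trail := S.trail ++ [a] }

/-- `S` turns into `T` by Decide, which adds the annotated literal `a`. -/
def DecideStep (lt : L.Term V → L.Term V → Prop) (S T : State L V) (a : AnnLit L V) : Prop :=
  S.status = .top ∧
  ∃ (C₀ : Clause L V) (K : Literal L V) (σ : Subst L V)
    (P : List (RewriteStep L V)) (I : RewriteStep L V),
    (C₀ + {K}) ∈ S.N ∪ S.U ∧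
    Clause.Ground (Clause.subst (C₀ + {K}) σ) ∧
    (ClauseBUndef lt S.β (Trail.lits S.trail) (Clause.subst C₀ σ) ∨
      ClauseBTrue lt S.β (Trail.lits S.trail) (Clause.subst C₀ σ)) ∧
    BUndef lt S.β (Trail.lits S.trail) (K.subst σ) ∧
    ClauseBelow lt S.β (Clause.subst (C₀ + {K}) σ) ∧
    IrreducibleSubst (conv lt (Trail.lits S.trail)) σ ∧
    IsReductionChainApp lt S.trail ⟨S.k + 1, K, C₀, σ⟩ P ∧
    P.getLast? = some I ∧
    a = ⟨S.k + 1, I.lead, {I.lead.comp}, I.sub⟩ ∧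
    T = { S with trail := S.trail ++ [a], k := S.k + 1 }

open Classical in
def ConflictStep (lt : L.Term V → L.Term V → Prop) (S T : State L V) : Prop :=
  S.status = .top ∧
  ∃ (D : Clause L V) (σ : Subst L V),
    D ∈ S.N ∪ S.U ∧
    Clause.Ground (Clause.subst D σ) ∧
    ClauseBFalse lt S.β (Trail.lits S.trail) (Clause.subst D σ) ∧
    IrreducibleSubst (conv lt (Trail.lits S.trail)) σ ∧
    T = { S with status :=
            if clauseLevel S.trail (Clause.subst D σ) = 0 then .bot else .conflict D σ }

def SkipStep (lt : L.Term V → L.Term V → Prop) (S T : State L V) : Prop :=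
  ∃ (Γ : Trail L V) (a b : AnnLit L V) (D : Clause L V) (σ : Subst L V),
    S.trail = Γ ++ [a, b] ∧
    S.status = .conflict D σ ∧
    ClauseBFalse lt S.β (Trail.lits (Γ ++ [a])) (Clause.subst D σ) ∧
    T = { S with trail := Γ ++ [a], k := a.level }

/-- Explore-Refutation. Here `≺_{Γ*}`, refutations and falsity refer to the whole current trail. -/
def ExploreRefutationStep (lt : L.Term V → L.Term V → Prop) (S T : State L V) : Prop :=
  ∃ (D : Clause L V) (K : Literal L V) (σ : Subst L V) (i : Fin (List.length S.trail))
    (P : List (RewriteStep L V)) (I : RewriteStep L V),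
    S.status = .conflict (D + {K}) σ ∧
    (∀ H ∈ Clause.subst D σ, H ≠ K.subst σ ∧ ¬ TrailLT lt S.β S.trail (K.subst σ) H) ∧
    (i : ℕ) + 1 = List.length S.trail ∧
    IsDefiningIndex S.trail (K.subst σ) i ∧
    IsRefutation lt S.β S.trail ⟨S.k, K, D, σ⟩ P ∧
    I ∈ P ∧
    MulLT (TrailLT lt S.β S.trail) (Clause.subst I.clause I.sub) (Clause.subst (D + {K}) σ) ∧
    ClauseBFalse lt S.β (Trail.lits S.trail) (Clause.subst I.clause I.sub) ∧
    T = { S with status := .conflict I.clause I.sub }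

def FactorizeStep (S T : State L V) : Prop :=
  ∃ (D : Clause L V) (K K' : Literal L V) (σ μ : Subst L V),
    S.status = .conflict (D + {K} + {K'}) σ ∧
    K.subst σ = K'.subst σ ∧
    IsLitMgu σ K {K'} μ ∧
    T = { S with status := .conflict (Clause.subst (D + {K}) μ) σ }

def EqualityResolutionStep (S T : State L V) : Prop :=
  ∃ (D : Clause L V) (s s' : L.Term V) (σ μ : Subst L V),
    S.status = .conflict (D + {⟨false, s(s, s')⟩}) σ ∧
    s.subst σ = s'.subst σ ∧
    IsMgu {(s, s')} μ ∧
    T = { S with status := .conflict (Clause.subst D μ) σ }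

/-- Some ground instance of `C` is `β`-false in `Γ, a` but not in `Γ`. -/
def BecomesFalse (lt : L.Term V → L.Term V → Prop) (β : L.Term V) (Γ : Trail L V) (a : AnnLit L V)
    (C : Clause L V) : Prop :=
  ∃ τ : Subst L V, Clause.Ground (Clause.subst C τ) ∧
    ClauseBFalse lt β (Trail.lits (Γ ++ [a])) (Clause.subst C τ) ∧
    ¬ ClauseBFalse lt β (Trail.lits Γ) (Clause.subst C τ)

open Classical in
def BacktrackStep (lt : L.Term V → L.Term V → Prop) (S T : State L V) : Prop :=
  ∃ (Γ Γ' : Trail L V) (a : AnnLit L V) (D : Clause L V) (K : Literal L V) (σ : Subst L V),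
    S.trail = Γ ++ [a] ++ Γ' ∧
    S.status = .conflict (D + {K}) σ ∧
    clauseLevel S.trail (Clause.subst D σ) < S.k ∧
    BecomesFalse lt S.β Γ a (D + {K}) ∧
    (∀ (Δ Δ' : Trail L V) (b : AnnLit L V), S.trail = Δ ++ [b] ++ Δ' →
      BecomesFalse lt S.β Δ b (D + {K}) → List.length Γ ≤ List.length Δ) ∧
    T = { S with
          trail := Γ
          U := S.U ∪ {D + {K}}
          k := a.level - (if IsDecision Γ a then 1 else 0)
          status := .top }

def GrowStep (lt : L.Term V → L.Term V → Prop) (S T : State L V) : Prop :=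
  S.status = .top ∧
  ∃ β' : L.Term V, TGround β' ∧ lt S.β β' ∧
    T = { S with trail := [], β := β', k := 0 }

/-- `S` turns into `T` by one application of the given rule. -/
def Step (lt : L.Term V → L.Term V → Prop) : Rule → State L V → State L V → Prop
  | .propagate, S, T => ∃ a, PropagateStep lt S T a
  | .decide, S, T => ∃ a, DecideStep lt S T a
  | .conflict, S, T => ConflictStep lt S T
  | .skip, S, T => SkipStep lt S T
  | .exploreRefutation, S, T => ExploreRefutationStep lt S T
  | .factorize, S, T => FactorizeStep S T
  | .equalityResolution, S, T => EqualityResolutionStep S T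
  | .backtrack, S, T => BacktrackStep lt S T
  | .grow, S, T => GrowStep lt S T

def Applicable (lt : L.Term V → L.Term V → Prop) (r : Rule) (S : State L V) : Prop :=
  ∃ T, Step lt r S T

/-! ### Runs -/

/-- A run of length `n ≤ ∞` from the initial state: for `i < n`, the `i`-th step leads from `s i` to
`s (i + 1)` by the rule `r i`. -/
def IsRun (lt : L.Term V → L.Term V → Prop) (N : Set (Clause L V)) (β : L.Term V) (n : ℕ∞)
    (s : ℕ → State L V) (r : ℕ → Rule) : Prop :=
  s 0 = initialState N β ∧ ∀ i : ℕ, (i : ℕ∞) < n → Step lt (r i) (s i) (s (i + 1))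

/-- Regular runs. -/
structure IsRegularRun (lt : L.Term V → L.Term V → Prop) (N : Set (Clause L V)) (β : L.Term V)
    (n : ℕ∞) (s : ℕ → State L V) (r : ℕ → Rule) : Prop where
  run : IsRun lt N β n s r
  /-- Conflict and Factorize have precedence over all other rules. -/
  precedence : ∀ i : ℕ, (i : ℕ∞) < n → r i ≠ .conflict → r i ≠ .factorize →
    ¬ Applicable lt .conflict (s i) ∧ ¬ Applicable lt .factorize (s i)
  /-- At level `0`, Propagate has precedence over Decide. -/
  propagate_first : ∀ i : ℕ, (i : ℕ∞) < n → r i = .decide → (s i).k = 0 →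
    ¬ Applicable lt .propagate (s i)
  /-- Decide does not add the complement of a literal that Propagate could add with an annotation
  clause from `N ∪ U`. -/
  no_complement : ∀ i : ℕ, (i : ℕ∞) < n → r i = .decide →
    ∀ (T : State L V) (a b : AnnLit L V), PropagateStep lt (s i) T a →
      a.clause ∈ (s i).N ∪ (s i).U → (s (i + 1)).trail = (s i).trail ++ [b] →
      b.lit ≠ a.lit.comp
  /-- If the last Conflict before Backtrack was not immediately preceded by Decide, then Skip was
  applied in between. -/
  skip_once : ∀ i j : ℕ, (i : ℕ∞) < n → r i = .backtrack → j < i → r j = .conflict →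
    (∀ l, j < l → l < i → r l ≠ .conflict) → ¬ (0 < j ∧ r (j - 1) = .decide) →
    ∃ l, j < l ∧ l < i ∧ r l = .skip
  /-- If it was, then the conflict clause contains the complement of the last trail literal. -/
  after_decide : ∀ i j : ℕ, (i : ℕ∞) < n → r i = .backtrack → j < i → r j = .conflict →
    (∀ l, j < l → l < i → r l ≠ .conflict) → (0 < j ∧ r (j - 1) = .decide) →
    ∃ (Γ : Trail L V) (a : AnnLit L V) (D : Clause L V) (σ : Subst L V),
      (s i).trail = Γ ++ [a] ∧ (s i).status = .conflict D σ ∧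
      ∃ K ∈ D, K.subst σ = a.lit.comp

end Basics

end SCLEQ

/-!
Every Backtrack makes the set `N ∪ U` learn a clause that has a `β`-false instance whose profile,
the set of its literals together with the set of those that occur exactly once, no instance of a
clause in `N ∪ U` had before. Only finitely many ground literals lie below `β`, so there are only
finitely many profiles. Between two Backtracks, the trail grows up to the number of these literals;
after a conflict, either it shrinks, or the conflict closure decreases in the well-founded ordering
`≺_{Γ*}`.

The profile is new because of regularity. If Skip was applied after the last conflict, then the
learned clause is false in a proper prefix of the trail at that conflict, in which Conflict was not
applicable. If the conflict was found right after Decide, then an old clause with an instance of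
that profile would have allowed Propagate to add the complement of the decision literal. This fails
if `N ∪ U` contains a clause with an instance that is `β`-false in the empty trail, but then
Conflict precedes Propagate and Decide forever, and every Backtrack shortens the trail.
-/

namespace SCLEQ

open FirstOrder.Language

section Multisets

variable {α : Type*} {r : α → α → Prop} {M N : Multiset α}

theorem singleton_eq_add {b : α} {X Z : Multiset α} (h : {b} = X + Z) :
    X = {b} ∧ Z = 0 ∨ X = 0 ∧ Z = {b} := by
  induction X using Multiset.induction_on with
  | empty => exact .inr ⟨rfl, by simpa using h.symm⟩
  | cons a X _ =>
    rw [Multiset.cons_add, Multiset.singleton_eq_cons_iff] at h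
    obtain ⟨rfl, h⟩ := h
    obtain ⟨rfl, rfl⟩ : X = 0 ∧ Z = 0 := by simpa using h
    exact .inl ⟨rfl, rfl⟩

theorem mulLT_singleton_iff {b : α} : MulLT r M {b} ↔ ∀ a ∈ M, r a b := by
  constructor
  · rintro ⟨X, Y, Z, hZ, rfl, hXZ, hYZ⟩ a ha
    rcases singleton_eq_add hXZ with ⟨-, rfl⟩ | ⟨rfl, rfl⟩
    · exact absurd rfl hZ
    · simpa using hYZ a (by simpa using ha)
  · exact fun h => ⟨0, M, {b}, by simp, by simp, by simp, fun a ha => ⟨b, by simp, h a ha⟩⟩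

theorem mulLT_add_right {Z : Multiset α} (hZ : Z ≠ 0) : MulLT r M (M + Z) :=
  ⟨M, 0, Z, hZ, by simp, rfl, by simp⟩

theorem MulLT.isDershowitzMannaLT_map {γ : Type*} [Preorder γ] {f : α → γ} (h : MulLT r M N)
    (hf : ∀ a, ∀ b ∈ N, r a b → f a < f b) :
    Multiset.IsDershowitzMannaLT (M.map f) (N.map f) := by
  obtain ⟨X, Y, Z, hZ, rfl, rfl, hYZ⟩ := h
  refine ⟨X.map f, Y.map f, Z.map f, by simpa using hZ, by simp, by simp, fun c hc => ?_⟩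
  obtain ⟨y, hy, rfl⟩ := Multiset.mem_map.1 hc
  obtain ⟨z, hz, hyz⟩ := hYZ y hy
  exact ⟨f z, Multiset.mem_map_of_mem f hz, hf y z (Multiset.mem_add.2 (.inr hz)) hyz⟩

theorem wellFounded_mulLT (h : WellFounded r) : WellFounded (MulLT r) :=
  Subrelation.wf
    (fun h' => h'.isDershowitzMannaLT_map fun _ b _ hab => Acc.rank_lt_of_rel (h.apply b) hab)
    (InvImage.wf (Multiset.map fun a => (h.apply a).rank)
      Multiset.wellFounded_isDershowitzMannaLT)

end Multisets

section Terms

variable {L : FirstOrder.Language.{u, v}} {V : Type w} {lt : L.Term V → L.Term V → Prop}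

theorem subst_subst (t : L.Term V) (σ τ : Subst L V) :
    (t.subst σ).subst τ = t.subst (Subst.comp σ τ) := by
  induction t with
  | var x => rfl
  | func f ts ih => simp [Term.subst, ih]

theorem subst_var (t : L.Term V) : t.subst Term.var = t := by
  induction t with
  | var x => rfl
  | func f ts ih => simp [Term.subst, ih]

theorem subst_congr {t : L.Term V} {σ τ : Subst L V} (h : ∀ x ∈ tvars t, σ x = τ x) :
    t.subst σ = t.subst τ := by
  induction t with
  | var x => exact h x rfl
  | func f ts ih =>
    simp only [Term.subst, fun i => ih i fun x hx => h x (Set.mem_iUnion.2 ⟨i, hx⟩)]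

theorem TGround.subst_eq {t : L.Term V} (h : TGround t) (σ : Subst L V) : t.subst σ = t := by
  have hcongr : t.subst σ = t.subst Term.var := subst_congr fun x hx => by simp_all [TGround]
  rw [hcongr, subst_var]

theorem exists_subtermAt_of_mem_tvars {t : L.Term V} {x : V} (h : x ∈ tvars t) :
    ∃ p, ∀ σ : Subst L V, subtermAt (t.subst σ) p = some (σ x) := by
  induction t with
  | var y =>
    obtain rfl : x = y := h
    exact ⟨[], fun σ => by simp [subtermAt, Term.subst]⟩
  | func f ts ih =>
    obtain ⟨i, hi⟩ := Set.mem_iUnion.1 h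
    obtain ⟨p, hp⟩ := ih i hi
    exact ⟨i :: p, fun σ => by simp [subtermAt, Term.subst, hp]⟩

theorem replaceAt_of_subtermAt {t s : L.Term V} {p : List ℕ} (h : subtermAt t p = some s) :
    replaceAt t p s = t := by
  induction t generalizing p with
  | var x => cases p <;> simp_all [subtermAt, replaceAt]
  | @func n f ts ih =>
    cases p with
    | nil => simp_all [subtermAt, replaceAt]
    | cons i p =>
      by_cases hi : i < n
      · simp only [subtermAt, hi, dif_pos] at h
        simp [replaceAt, hi, ih _ h]
      · simp [subtermAt, hi] at h

theorem realize_replaceAt {t s s' : L.Term V} {p : List ℕ} {M : Type*} [L.Structure M]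
    {val : V → M} (h : subtermAt t p = some s) (e : s'.realize val = s.realize val) :
    (replaceAt t p s').realize val = t.realize val := by
  induction t generalizing p with
  | var x => cases p <;> simp_all [subtermAt, replaceAt]
  | @func n f ts ih =>
    cases p with
    | nil => simp_all [subtermAt, replaceAt]
    | cons i p =>
      by_cases hi : i < n
      · simp only [subtermAt, hi, dif_pos] at h
        simp only [replaceAt, hi, dif_pos, Term.realize_func]
        congr 1
        funext j
        rcases eq_or_ne j ⟨i, hi⟩ with rfl | hj
        · simp [ih _ h]
        · simp [Function.update_of_ne hj]
      · simp [subtermAt, hi] at h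

/-- Substituting the ground term `g` for the variables of `t` turns `t ≺ g` into a context `c` with
`c[g] ≺ g`, and iterating `c` descends forever. -/
theorem IsDesiredTermOrdering.ground_of_lt (hlt : IsDesiredTermOrdering lt) {t g : L.Term V}
    (hg : TGround g) (h : lt t g) : TGround t := by
  by_contra ht
  obtain ⟨x, hx⟩ := Set.nonempty_iff_ne_empty.2 ht
  obtain ⟨p, hp⟩ := exists_subtermAt_of_mem_tvars hx
  set q := t.subst fun _ => g
  have hqp : subtermAt q p = some g := hp fun _ => g
  have hqg : lt (replaceAt q p g) g := by
    rw [replaceAt_of_subtermAt hqp, ← hg.subst_eq fun _ => g]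
    exact hlt.subst _ _ _ h
  obtain ⟨m, hm, hmin⟩ := hlt.wellFounded.has_min {y | lt (replaceAt q p y) y} ⟨g, hqg⟩
  exact hmin _ (hlt.context q p _ _ (by simp [hqp]) hm) hm

end Terms

section Rewriting

variable {L : FirstOrder.Language.{u, v}} {V : Type w} {lt : L.Term V → L.Term V → Prop}
  {Γ : Set (Literal L V)} {R : Set (L.Term V × L.Term V)} {s t : L.Term V}

theorem Rewrites.func_update {n : ℕ} (f : L.Functions n) (ts : Fin n → L.Term V) (i : Fin n)
    (h : Rewrites R s t) :
    Rewrites R (.func f (Function.update ts i s)) (.func f (Function.update ts i t)) := by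
  obtain ⟨e, he, p, σ, hs, rfl⟩ := h
  exact ⟨e, he, i :: p, σ, by simpa [subtermAt] using hs, by simp [replaceAt]⟩

theorem reflTransGen_rewrites_func {n : ℕ} (f : L.Functions n) {ts us : Fin n → L.Term V}
    (h : ∀ i, Relation.ReflTransGen (Rewrites R) (ts i) (us i)) :
    Relation.ReflTransGen (Rewrites R) (.func f ts) (.func f us) := by
  suffices key : ∀ S : Finset (Fin n),
      Relation.ReflTransGen (Rewrites R) (.func f ts) (.func f (S.piecewise us ts)) by
    simpa using key Finset.univ
  intro S
  induction S using Finset.induction_on with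
  | empty => simpa using .refl
  | insert i S hi ih =>
    have hstep := (h i).lift (fun t => Term.func f (Function.update (S.piecewise us ts) i t))
      fun _ _ h => h.func_update f _ i
    rw [Function.onFun, ← Finset.piecewise_insert, ← Finset.piecewise_eq_of_notMem S us ts hi,
      Function.update_eq_self] at hstep
    exact ih.trans hstep

theorem reflTransGen_rewrites_subst (t : L.Term V) {σ τ : Subst L V}
    (h : ∀ x, Relation.ReflTransGen (Rewrites R) (σ x) (τ x)) :
    Relation.ReflTransGen (Rewrites R) (t.subst σ) (t.subst τ) := by
  induction t with
  | var x => exact h x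
  | func f ts ih => exact reflTransGen_rewrites_func f ih

theorem Irreducible.eq_of_reflTransGen (hs : Irreducible R s)
    (h : Relation.ReflTransGen (Rewrites R) s t) : t = s :=
  h.cases_head.elim Eq.symm fun ⟨u, hu, _⟩ => absurd hu (hs u)

theorem lt_of_rewrites (hlt : IsDesiredTermOrdering lt) (h : Rewrites (conv lt Γ) s t) :
    lt t s := by
  obtain ⟨e, ⟨hl, hr, hrl, -⟩, p, σ, hs, rfl⟩ := h
  rw [hl.subst_eq] at hs
  have hctx := hlt.context s p _ _ (by simp [hs]) hrl
  rwa [replaceAt_of_subtermAt hs, ← hr.subst_eq σ] at hctx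

theorem eq_or_lt_of_reflTransGen_rewrites (hlt : IsDesiredTermOrdering lt)
    (h : Relation.ReflTransGen (Rewrites (conv lt Γ)) s t) : t = s ∨ lt t s := by
  induction h with
  | refl => exact .inl rfl
  | tail _ h ih => exact .inr (ih.elim (· ▸ lt_of_rewrites hlt h)
      (hlt.trans _ _ _ (lt_of_rewrites hlt h)))

theorem holds_mk_true {M : Type*} [L.Structure M] {val : V → M} :
    Literal.Holds (⟨true, s(s, t)⟩ : Literal L V) M val ↔ s.realize val = t.realize val := by
  simp [Literal.Holds]

theorem entails_of_rewrites (h : Rewrites (conv lt Γ) s t) : Entails Γ ⟨true, s(t, s)⟩ := by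
  obtain ⟨e, ⟨hl, hr, -, he⟩, p, σ, hs, rfl⟩ := h
  rw [hl.subst_eq] at hs
  rw [hr.subst_eq]
  intro M _ val hM
  exact holds_mk_true.2 <| realize_replaceAt hs <|
    (holds_mk_true.1 (he M val fun H hH => hM H hH.1)).symm

theorem entails_of_reflTransGen_rewrites
    (h : Relation.ReflTransGen (Rewrites (conv lt Γ)) s t) : Entails Γ ⟨true, s(t, s)⟩ := by
  intro M _ val hM
  induction h with
  | refl => exact holds_mk_true.2 rfl
  | tail _ h ih =>
    have hstep := holds_mk_true.1 (entails_of_rewrites h M val hM)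
    exact holds_mk_true.2 (hstep.trans (holds_mk_true.1 ih))

theorem exists_isNormalForm (hlt : IsDesiredTermOrdering lt) (Γ : Set (Literal L V))
    (s : L.Term V) : ∃ t, IsNormalForm (conv lt Γ) s t := by
  induction s using hlt.wellFounded.induction with
  | _ s ih =>
    by_cases hs : Irreducible (conv lt Γ) s
    · exact ⟨s, .refl, hs⟩
    · obtain ⟨t, hst⟩ : ∃ t, Rewrites (conv lt Γ) s t := by simpa [Irreducible] using hs
      obtain ⟨u, htu, hu⟩ := ih t (lt_of_rewrites hlt hst)
      exact ⟨u, .head hst htu, hu⟩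

theorem exists_irreducibleSubst (hlt : IsDesiredTermOrdering lt) (Γ : Set (Literal L V))
    (σ : Subst L V) : ∃ τ : Subst L V, IrreducibleSubst (conv lt Γ) τ ∧
      ∀ x, Relation.ReflTransGen (Rewrites (conv lt Γ)) (σ x) (τ x) := by
  choose nf hnf using exists_isNormalForm hlt Γ
  exact ⟨fun x => nf (σ x), fun x _ => (hnf (σ x)).2, fun x => (hnf (σ x)).1⟩

end Rewriting

section Literals

variable {L : FirstOrder.Language.{u, v}} {V : Type w} {lt : L.Term V → L.Term V → Prop}
  {β : L.Term V} {K H : Literal L V} {C : Clause L V}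

@[simp]
theorem Literal.comp_comp (K : Literal L V) : K.comp.comp = K := by
  simp [Literal.comp]

theorem Literal.comp_ne (K : Literal L V) : K.comp ≠ K := by
  simp [Literal.comp, Literal.ext_iff]

theorem Literal.subst_subst (K : Literal L V) (σ τ : Subst L V) :
    (K.subst σ).subst τ = K.subst (Subst.comp σ τ) := by
  simp [Literal.subst, Sym2.map_map, SCLEQ.subst_subst]

theorem Literal.subst_var (K : Literal L V) : K.subst Term.var = K := by
  simp [Literal.subst, SCLEQ.subst_var]

theorem Literal.mem_toMultiset {t : L.Term V} : t ∈ K.toMultiset ↔ t ∈ K.eqn := by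
  unfold Literal.toMultiset
  split <;> simp

theorem Literal.ground_iff : K.Ground ↔ ∀ t ∈ K.eqn, TGround t := by
  simp only [Literal.Ground, Literal.vars, TGround, Set.eq_empty_iff_forall_notMem,
    Set.mem_ofPred_eq, not_exists, not_and]
  exact ⟨fun h t ht x => h x t ht, fun h x t ht => h t ht x⟩

theorem Clause.ground_iff : Clause.Ground C ↔ ∀ K ∈ C, K.Ground := by
  simp only [Clause.Ground, Clause.vars, Literal.Ground, Set.eq_empty_iff_forall_notMem,
    Set.mem_ofPred_eq, not_exists, not_and]
  exact ⟨fun h K hK x => h x K hK, fun h x K hK => h K hK x⟩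

theorem Clause.subst_subst (C : Clause L V) (σ τ : Subst L V) :
    Clause.subst (Clause.subst C σ) τ = Clause.subst C (Subst.comp σ τ) := by
  simp [Clause.subst, Literal.subst_subst]

theorem Clause.subst_var (C : Clause L V) : Clause.subst C Term.var = C := by
  simp [Clause.subst, Literal.subst_var]

theorem litBelow_iff : LitBelow lt β K ↔ ∀ t ∈ K.eqn, lt t β := by
  simp [LitBelow, mulLT_singleton_iff, Literal.mem_toMultiset]

theorem clauseBelow_iff : ClauseBelow lt β C ↔ ∀ K ∈ C, LitBelow lt β K := by
  simp [ClauseBelow, mulLT_singleton_iff, LitBelow]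

theorem LitBelow.comp (h : LitBelow lt β K) : LitBelow lt β K.comp :=
  litBelow_iff.2 fun t ht => litBelow_iff.1 h t ht

theorem LitBelow.not_litAbove (hwf : WellFounded lt) (h : LitBelow lt β K) :
    ¬ LitAbove lt β K :=
  (wellFounded_mulLT hwf).asymmetric _ _ h

theorem LitBelow.ground (hlt : IsDesiredTermOrdering lt) (hβ : TGround β)
    (h : LitBelow lt β K) : K.Ground :=
  Literal.ground_iff.2 fun t ht => hlt.ground_of_lt hβ (litBelow_iff.1 h t ht)

theorem finite_litBelow (hlt : IsDesiredTermOrdering lt) (hβ : TGround β) :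
    {K : Literal L V | LitBelow lt β K}.Finite := by
  have hbelow := hlt.finite_below β hβ
  refine ((Set.finite_univ.prod (hbelow.prod hbelow)).image fun q : Bool × L.Term V × L.Term V =>
    (⟨q.1, s(q.2.1, q.2.2)⟩ : Literal L V)).subset ?_
  rintro ⟨b, ⟨s, t⟩⟩ hK
  have hK := litBelow_iff.1 hK
  have hs : lt s β := hK s (Sym2.mem_mk_left s t)
  have ht : lt t β := hK t (Sym2.mem_mk_right s t)
  exact ⟨(b, s, t), ⟨trivial, ⟨hlt.ground_of_lt hβ hs, hs⟩, hlt.ground_of_lt hβ ht, ht⟩, rfl⟩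

end Literals

section Unifiers

variable {L : FirstOrder.Language.{u, v}} {V : Type w} {σ μ : Subst L V}

theorem IsMgu.comp_eq {E : Set (L.Term V × L.Term V)} (h : IsMgu E μ) (hσ : Unifies σ E) :
    Subst.comp μ σ = σ := by
  obtain ⟨ρ, rfl⟩ := h.most_general σ hσ
  calc Subst.comp μ (Subst.comp μ ρ) = Subst.comp (Subst.comp μ μ) ρ :=
        funext fun x => (subst_subst (μ x) μ ρ).symm
    _ = Subst.comp μ ρ := by rw [h.idempotent]

theorem IsLitMgu.comp_eq {K : Literal L V} {S : Clause L V} (h : IsLitMgu σ K S μ) :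
    Subst.comp μ σ = σ := by
  obtain ⟨s, t, P, -, -, hP, hμ⟩ := h
  refine hμ.comp_eq ?_
  rintro e ⟨q, hq, rfl | rfl⟩
  · exact (hP q hq).1.symm
  · exact (hP q hq).2.symm

theorem isLitMgu_zero (σ : Subst L V) (K : Literal L V) : IsLitMgu σ K 0 Term.var := by
  obtain ⟨b, ⟨s, t⟩⟩ := K
  exact ⟨s, t, 0, rfl, by simp, by simp,
    ⟨by simp [Unifies], fun θ _ => ⟨θ, rfl⟩, rfl, fun x hx => absurd rfl hx⟩⟩

end Unifiers

section Semantics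

variable {L : FirstOrder.Language.{u, v}} {V : Type w} {lt : L.Term V → L.Term V → Prop}
  {β : L.Term V} {Γ Δ : Set (Literal L V)} {K H : Literal L V} {C D : Clause L V}

theorem Literal.holds_comp {M : Type*} [L.Structure M] {val : V → M} :
    K.comp.Holds M val ↔ ¬ K.Holds M val := by
  unfold Literal.Holds Literal.comp
  cases K.pos <;> simp

theorem entails_of_mem (h : K ∈ Γ) : Entails Γ K := fun _ _ _ hM => hM K h

theorem Entails.mono (hs : Γ ⊆ Δ) (h : Entails Γ K) : Entails Δ K :=
  fun M _ val hM => h M val fun H hH => hM H (hs hH)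

theorem Defined.mono (hs : Γ ⊆ Δ) (h : Defined Γ K) : Defined Δ K :=
  h.imp (Entails.mono hs) (Entails.mono hs)

theorem defined_comp_iff : Defined Γ K.comp ↔ Defined Γ K := by
  simp [Defined, or_comm]

/-- If `Γ` entailed the complement of `K`, then `H` would be contradictory in `Γ`. -/
theorem entails_of_entails_insert (hH : ¬ Defined Γ H) (hK : Defined Γ K)
    (h : Entails (insert H Γ) K) : Entails Γ K := by
  refine hK.resolve_right fun hcomp => hH (.inr fun M _ val hM => ?_)
  refine Literal.holds_comp.2 fun hHM => ?_
  exact Literal.holds_comp.1 (hcomp M val hM) (h M val (by simpa using ⟨hHM, hM⟩))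

theorem BFalse.mono (hs : Γ ⊆ Δ) (h : BFalse lt β Γ K) : BFalse lt β Δ K :=
  ⟨h.1, h.2.mono hs⟩

theorem BFalse.not_bUndef (hwf : WellFounded lt) (h : BFalse lt β Γ K) : ¬ BUndef lt β Γ K :=
  not_or.2 ⟨h.1.not_litAbove hwf, not_not.2 (.inr h.2)⟩

theorem ClauseBFalse.mono (hs : Γ ⊆ Δ) (h : ClauseBFalse lt β Γ C) : ClauseBFalse lt β Δ C :=
  fun K hK => (h K hK).mono hs

theorem ClauseBFalse.of_subset (hs : C ⊆ D) (h : ClauseBFalse lt β Γ D) : ClauseBFalse lt β Γ C :=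
  fun K hK => h K (hs hK)

theorem ClauseBFalse.ground (hlt : IsDesiredTermOrdering lt) (hβ : TGround β)
    (h : ClauseBFalse lt β Γ C) : Clause.Ground C :=
  Clause.ground_iff.2 fun K hK => (h K hK).1.ground hlt hβ

end Semantics

section LiteralReduction

variable {L : FirstOrder.Language.{u, v}} {V : Type w} {lt : L.Term V → L.Term V → Prop}
  {β : L.Term V} {Γ : Set (Literal L V)} {R : Set (L.Term V × L.Term V)} {K H : Literal L V}

/-- `K` rewrites to `H`: both sides of `H` are obtained from those of `K` by finitely many rewrite
steps. This covers normal forms of literals and literals under normalized substitutions alike. -/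
def LitReduces (R : Set (L.Term V × L.Term V)) (K H : Literal L V) : Prop :=
  ∃ b s t s' t', K = ⟨b, s(s, t)⟩ ∧ H = ⟨b, s(s', t')⟩ ∧
    Relation.ReflTransGen (Rewrites R) s s' ∧ Relation.ReflTransGen (Rewrites R) t t'

theorem LitReduces.comp (h : LitReduces R K H) : LitReduces R K.comp H.comp := by
  obtain ⟨b, s, t, s', t', rfl, rfl, hs, ht⟩ := h
  exact ⟨!b, s, t, s', t', rfl, rfl, hs, ht⟩

theorem IsLitNormalForm.litReduces (h : IsLitNormalForm R K H) : LitReduces R K H := by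
  obtain ⟨s, t, s', t', hK, hH, hs, ht⟩ := h
  exact ⟨K.pos, s, t, s', t', hK, hH, hs.1, ht.1⟩

theorem IsLitNormalForm.irreducible (h : IsLitNormalForm R K H) :
    ∀ t ∈ H.eqn, Irreducible R t := by
  obtain ⟨s, t, s', t', -, rfl, hs, ht⟩ := h
  simpa using ⟨hs.2, ht.2⟩

theorem isLitNormalForm_self (h : ∀ t ∈ K.eqn, Irreducible R t) : IsLitNormalForm R K K := by
  obtain ⟨b, ⟨s, t⟩⟩ := K
  exact ⟨s, t, s, t, rfl, rfl, ⟨.refl, h s (Sym2.mem_mk_left s t)⟩,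
    ⟨.refl, h t (Sym2.mem_mk_right s t)⟩⟩

theorem litReduces_subst {σ τ : Subst L V} (K : Literal L V)
    (h : ∀ x, Relation.ReflTransGen (Rewrites R) (σ x) (τ x)) :
    LitReduces R (K.subst σ) (K.subst τ) := by
  obtain ⟨b, ⟨s, t⟩⟩ := K
  exact ⟨b, s.subst σ, t.subst σ, s.subst τ, t.subst τ, rfl, rfl,
    reflTransGen_rewrites_subst s h, reflTransGen_rewrites_subst t h⟩

theorem LitReduces.eq_of_irreducible (h : LitReduces R K H)
    (hK : ∀ t ∈ K.eqn, Irreducible R t) : H = K := by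
  obtain ⟨b, s, t, s', t', rfl, rfl, hs, ht⟩ := h
  rw [(hK s (Sym2.mem_mk_left s t)).eq_of_reflTransGen hs,
    (hK t (Sym2.mem_mk_right s t)).eq_of_reflTransGen ht]

theorem LitReduces.litBelow (hlt : IsDesiredTermOrdering lt) (h : LitReduces (conv lt Γ) K H)
    (hK : LitBelow lt β K) : LitBelow lt β H := by
  have below_of_reduct : ∀ {s s' : L.Term V}, lt s β →
      Relation.ReflTransGen (Rewrites (conv lt Γ)) s s' → lt s' β := fun hs hss' =>
    (eq_or_lt_of_reflTransGen_rewrites hlt hss').elim (· ▸ hs) (hlt.trans _ _ _ · hs)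
  obtain ⟨b, s, t, s', t', rfl, rfl, hs, ht⟩ := h
  simp only [litBelow_iff, Sym2.mem_iff, forall_eq_or_imp, forall_eq] at hK ⊢
  exact ⟨below_of_reduct hK.1 hs, below_of_reduct hK.2 ht⟩

theorem LitReduces.entails_iff (h : LitReduces (conv lt Γ) K H) :
    Entails Γ K ↔ Entails Γ H := by
  obtain ⟨b, s, t, s', t', rfl, rfl, hs, ht⟩ := h
  refine forall₃_congr fun M _ val => imp_congr_right fun hM => ?_
  have hs' := holds_mk_true.1 (entails_of_reflTransGen_rewrites hs M val hM)
  have ht' := holds_mk_true.1 (entails_of_reflTransGen_rewrites ht M val hM)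
  simp [Literal.Holds, hs', ht']

theorem LitReduces.defined_iff (h : LitReduces (conv lt Γ) K H) :
    Defined Γ K ↔ Defined Γ H :=
  or_congr h.entails_iff h.comp.entails_iff

theorem LitReduces.bFalse (hlt : IsDesiredTermOrdering lt) (h : LitReduces (conv lt Γ) K H)
    (hK : BFalse lt β Γ K) : BFalse lt β Γ H :=
  ⟨h.litBelow hlt hK.1, h.comp.entails_iff.1 hK.2⟩

theorem ClauseBFalse.subst_of_reflTransGen (hlt : IsDesiredTermOrdering lt) {C : Clause L V}
    {σ τ : Subst L V} (h : ∀ x, Relation.ReflTransGen (Rewrites (conv lt Γ)) (σ x) (τ x))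
    (hC : ClauseBFalse lt β Γ (Clause.subst C σ)) :
    ClauseBFalse lt β Γ (Clause.subst C τ) := by
  intro H hH
  obtain ⟨K, hK, rfl⟩ := Multiset.mem_map.1 hH
  exact (litReduces_subst K h).bFalse hlt (hC _ (Multiset.mem_map_of_mem _ hK))

end LiteralReduction

section Trails

variable {L : FirstOrder.Language.{u, v}} {V : Type w} {lt : L.Term V → L.Term V → Prop}
  {β : L.Term V} {Γ Δ : Trail L V} {a : AnnLit L V} {K H : Literal L V}

theorem Trail.lits_append_singleton (Γ : Trail L V) (a : AnnLit L V) :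
    Trail.lits (Γ ++ [a]) = insert a.lit (Trail.lits Γ) := by
  ext K
  simp [Trail.lits, or_and_right, exists_or, or_comm, eq_comm]

theorem Trail.lits_mono (h : Γ ⊆ Δ) : Trail.lits Γ ⊆ Trail.lits Δ := by
  rintro _ ⟨a, ha, rfl⟩
  exact ⟨a, h ha, rfl⟩

/-- A trail is sound if each of its literals is below `β` and undefined in the part of the trail
to its left. This is all that the termination argument needs to know about the trails of a run. -/
def Trail.Sound (lt : L.Term V → L.Term V → Prop) (β : L.Term V) (Γ : Trail L V) : Prop :=
  ∀ Δ a, Δ ++ [a] <+: Γ → LitBelow lt β a.lit ∧ ¬ Defined (Trail.lits Δ) a.lit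

theorem Trail.sound_nil : Trail.Sound lt β ([] : Trail L V) :=
  fun Δ a h => absurd (List.prefix_nil.1 h) (by simp)

theorem Trail.Sound.of_prefix (hΔ : Trail.Sound lt β Δ) (h : Γ <+: Δ) : Trail.Sound lt β Γ :=
  fun _ _ h' => hΔ _ _ (h'.trans h)

theorem Trail.Sound.append_singleton (hΓ : Trail.Sound lt β Γ) (ha : LitBelow lt β a.lit)
    (hu : ¬ Defined (Trail.lits Γ) a.lit) : Trail.Sound lt β (Γ ++ [a]) := by
  intro Δ b h
  rcases List.prefix_concat_iff.1 h with h | h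
  · obtain ⟨rfl, rfl⟩ := List.append_singleton_inj.1 h
    exact ⟨ha, hu⟩
  · exact hΓ Δ b h

theorem Trail.take_append_get_prefix (Γ : Trail L V) (i : Fin (List.length Γ)) :
    List.take i Γ ++ [List.get Γ i] <+: Γ := by
  simpa using List.take_prefix (i + 1) Γ

theorem Trail.Sound.not_defined_get (hΓ : Trail.Sound lt β Γ) {i j : Fin (List.length Γ)}
    (hij : i < j) : (List.get Γ j).lit ≠ (List.get Γ i).lit ∧
      (List.get Γ j).lit ≠ (List.get Γ i).lit.comp := by
  have hj := (hΓ _ _ (Trail.take_append_get_prefix Γ j)).2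
  have hi : Defined (Trail.lits (List.take j Γ)) (List.get Γ i).lit :=
    .inl (entails_of_mem ⟨_, List.mem_take_iff_getElem.2 ⟨i, by simpa using hij, rfl⟩, rfl⟩)
  exact ⟨fun h => hj (h ▸ hi), fun h => hj (h ▸ defined_comp_iff.2 hi)⟩

theorem Trail.Sound.lit_get_injective (hΓ : Trail.Sound lt β Γ) :
    Function.Injective fun i : Fin (List.length Γ) => (List.get Γ i).lit :=
  .of_lt_imp_ne fun _ _ hij h => (hΓ.not_defined_get hij).1 h.symm

theorem Trail.Sound.lit_get_ne_comp (hΓ : Trail.Sound lt β Γ) (i j : Fin (List.length Γ)) :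
    (List.get Γ i).lit ≠ (List.get Γ j).lit.comp := by
  intro h
  rcases lt_trichotomy i j with hij | rfl | hij
  · exact (hΓ.not_defined_get hij).2 (by rw [h, Literal.comp_comp])
  · exact Literal.comp_ne _ h.symm
  · exact (hΓ.not_defined_get hij).2 h

theorem Trail.Sound.length_le (hlt : IsDesiredTermOrdering lt) (hβ : TGround β)
    (hΓ : Trail.Sound lt β Γ) : List.length Γ ≤ {K : Literal L V | LitBelow lt β K}.ncard := by
  have hrange : Set.range (fun i : Fin (List.length Γ) => (List.get Γ i).lit) ⊆
      {K | LitBelow lt β K} := by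
    rintro _ ⟨i, rfl⟩
    exact (hΓ _ _ (Trail.take_append_get_prefix Γ i)).1
  calc List.length Γ = (Set.range fun i : Fin (List.length Γ) => (List.get Γ i).lit).ncard := by
        rw [Set.ncard_range_of_injective hΓ.lit_get_injective, Nat.card_fin]
    _ ≤ _ := Set.ncard_le_ncard hrange (finite_litBelow hlt hβ)

end Trails

section Levels

variable {L : FirstOrder.Language.{u, v}} {V : Type w} {Γ : Trail L V} {a : AnnLit L V}
  {K : Literal L V}

theorem exists_isCore (h : Defined (Trail.lits Γ) K) : ∃ I, IsCore Γ K I := by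
  have huniv : Defined (Trail.litsAt Γ Finset.univ) K := h.mono <| by
    rintro _ ⟨a, ha, rfl⟩
    obtain ⟨i, rfl⟩ := List.get_of_mem ha
    exact ⟨i, Finset.mem_univ i, rfl⟩
  obtain ⟨I, hI, hmin⟩ := wellFounded_lt.has_min {I | Defined (Trail.litsAt Γ I) K} ⟨_, huniv⟩
  exact ⟨I, hI, fun J hJ hd => hmin J hd hJ⟩

theorem IsCore.nonempty {I : Finset (Fin (List.length Γ))} (hI : IsCore Γ K I)
    (h : ¬ Defined ∅ K) : I.Nonempty := by
  rw [Finset.nonempty_iff_ne_empty]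
  rintro rfl
  refine h (hI.1.mono ?_)
  rintro _ ⟨i, hi, -⟩
  exact absurd hi (Finset.notMem_empty i)

theorem exists_isDefiningIndex (h : Defined (Trail.lits Γ) K) (h' : ¬ Defined ∅ K) :
    ∃ i, IsDefiningIndex Γ K i := by
  have hmax (J) (hJ : IsCore Γ K J) : ∃ j ∈ J, ∀ i ∈ J, i ≤ j :=
    ⟨J.max' (hJ.nonempty h'), J.max'_mem _, J.le_max'⟩
  obtain ⟨I, hI⟩ := exists_isCore h
  obtain ⟨m, hm⟩ := hmax I hI
  obtain ⟨i, hi, hmin⟩ := wellFounded_lt.has_min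
    {i | ∃ I, IsCore Γ K I ∧ i ∈ I ∧ ∀ j ∈ I, j ≤ i} ⟨m, I, hI, hm⟩
  refine ⟨i, hi, fun J hJ => ?_⟩
  obtain ⟨j, hj, hj'⟩ := hmax J hJ
  exact ⟨j, hj, not_lt.1 (hmin j ⟨J, hJ, hj, hj'⟩)⟩

theorem IsDefiningIndex.unique {i j : Fin (List.length Γ)} (hi : IsDefiningIndex Γ K i)
    (hj : IsDefiningIndex Γ K j) : i = j := by
  obtain ⟨⟨I, hI, -, hI'⟩, hi⟩ := hi
  obtain ⟨⟨J, hJ, -, hJ'⟩, hj⟩ := hj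
  obtain ⟨x, hx, hix⟩ := hi J hJ
  obtain ⟨y, hy, hjy⟩ := hj I hI
  exact le_antisymm (hix.trans (hJ' x hx)) (hjy.trans (hI' y hy))

theorem IsDefiningIndex.defined_of_lt {i : Fin (List.length (Γ ++ [a]))}
    (hi : IsDefiningIndex (Γ ++ [a]) K i) (h : (i : ℕ) < List.length Γ) :
    Defined (Trail.lits Γ) K := by
  obtain ⟨⟨I, hI, -, hmax⟩, -⟩ := hi
  refine hI.1.mono ?_
  rintro _ ⟨j, hj, rfl⟩
  have hj' : (j : ℕ) < List.length Γ := lt_of_le_of_lt (hmax j hj) h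
  exact ⟨Γ[(j : ℕ)], List.getElem_mem _, by simp [List.getElem_append_left hj']⟩

theorem defined_of_litLevel_lt (h : Defined (Trail.lits (Γ ++ [a])) K)
    (hl : litLevel (Γ ++ [a]) K < a.level) : Defined (Trail.lits Γ) K := by
  by_cases h0 : Defined ∅ K
  · exact h0.mono (Set.empty_subset _)
  unfold litLevel at hl
  split_ifs at hl with hmem hidx
  · obtain ⟨hm, hK⟩ := hmem.choose_spec
    rcases List.mem_append.1 hm with hm | hm
    · exact .inl (entails_of_mem ⟨_, hm, hK⟩)
    · exact absurd hl (by rw [List.mem_singleton.1 hm]; exact lt_irrefl _)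
  · refine hidx.choose_spec.defined_of_lt (lt_of_le_of_ne ?_ fun hlast => ?_)
    · have := hidx.choose.2
      simp only [List.length_append, List.length_singleton] at this
      omega
    · exact absurd hl (by simp [List.get_eq_getElem, hlast])
  · exact absurd (exists_isDefiningIndex h h0) hidx

theorem litLevel_le_clauseLevel {C : Clause L V} (h : K ∈ C) :
    litLevel Γ K ≤ clauseLevel Γ C :=
  Multiset.le_sup (Multiset.mem_map_of_mem _ h)

end Levels

section TrailOrdering

variable {L : FirstOrder.Language.{u, v}} {V : Type w} {lt : L.Term V → L.Term V → Prop}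
  {β : L.Term V} {Γ : Trail L V} {K H : Literal L V}

open Classical in
/-- The position of a defined literal in the trail induced ordering, up to the comparison by
`≺_T`: level `0` comes first; then the `i`-th trail literal, its complement, and the other literals
that it defines occupy the positions `3i + 1`, `3i + 2` and `3i + 3`. -/
noncomputable def trailRank (Γ : Trail L V) (K : Literal L V) : ℕ :=
  if litLevel Γ K = 0 then 0
  else if h : ∃ i : Fin (List.length Γ), (List.get Γ i).lit = K then 3 * h.choose + 1
  else if h : ∃ i : Fin (List.length Γ), (List.get Γ i).lit.comp = K then 3 * h.choose + 2
  else if h : ∃ i, IsDefiningIndex Γ K i then 3 * h.choose + 3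
  else 0

theorem trailRank_of_litLevel_eq_zero (h : litLevel Γ K = 0) : trailRank Γ K = 0 := by
  simp [trailRank, h]

theorem trailRank_get (hΓ : Trail.Sound lt β Γ) (i : Fin (List.length Γ))
    (h : 0 < litLevel Γ (List.get Γ i).lit) : trailRank Γ (List.get Γ i).lit = 3 * i + 1 := by
  have hex : ∃ j : Fin (List.length Γ), (List.get Γ j).lit = (List.get Γ i).lit := ⟨i, rfl⟩
  rw [trailRank, if_neg h.ne', dif_pos hex, hΓ.lit_get_injective hex.choose_spec]

theorem trailRank_get_comp (hΓ : Trail.Sound lt β Γ) (i : Fin (List.length Γ))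
    (h : 0 < litLevel Γ (List.get Γ i).lit.comp) :
    trailRank Γ (List.get Γ i).lit.comp = 3 * i + 2 := by
  have hne : ¬ ∃ j : Fin (List.length Γ), (List.get Γ j).lit = (List.get Γ i).lit.comp :=
    fun ⟨j, hj⟩ => hΓ.lit_get_ne_comp j i hj
  have hex : ∃ j : Fin (List.length Γ), (List.get Γ j).lit.comp = (List.get Γ i).lit.comp :=
    ⟨i, rfl⟩
  have hi : hex.choose = i := hΓ.lit_get_injective <| by
    simpa only [Literal.comp_comp] using congrArg Literal.comp hex.choose_spec
  rw [trailRank, if_neg h.ne', dif_neg hne, dif_pos hex, hi]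

theorem IsMLit.trailRank_eq {i : Fin (List.length Γ)} (hK : IsMLit lt β Γ i K)
    (h : 0 < litLevel Γ K) : trailRank Γ K = 3 * i + 3 := by
  obtain ⟨-, hmem, hcomp, hi⟩ := hK
  have hex : ∃ i, IsDefiningIndex Γ K i := ⟨i, hi⟩
  have hne : ¬ ∃ j : Fin (List.length Γ), (List.get Γ j).lit = K := by
    rintro ⟨j, rfl⟩
    exact hmem ⟨_, List.get_mem Γ j, rfl⟩
  have hne' : ¬ ∃ j : Fin (List.length Γ), (List.get Γ j).lit.comp = K := by
    rintro ⟨j, rfl⟩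
    exact hcomp ⟨_, List.get_mem Γ j, by simp⟩
  rw [trailRank, if_neg h.ne', dif_neg hne, dif_neg hne', dif_pos hex, hex.choose_spec.unique hi]

theorem trailRank_pos (h : 0 < litLevel Γ K) : 0 < trailRank Γ K := by
  unfold trailRank
  split_ifs with h0 hget hcomp hidx
  · exact absurd h0 h.ne'
  · omega
  · omega
  · omega
  · refine absurd ?_ h.ne'
    rw [litLevel, dif_neg, dif_neg hidx]
    rintro ⟨a, ha, rfl⟩
    obtain ⟨i, rfl⟩ := List.get_of_mem ha
    exact hget ⟨i, rfl⟩

theorem TrailLT.trailRank_lt_or_litLT (hΓ : Trail.Sound lt β Γ) (h : TrailLT lt β Γ K H)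
    (hH : ¬ BUndef lt β (Trail.lits Γ) H) :
    trailRank Γ K < trailRank Γ H ∨ trailRank Γ K = trailRank Γ H ∧ LitLT lt K H := by
  cases h.2.2 with
  | m_m_lt hK hH lK lH h => rw [hK.trailRank_eq lK, hH.trailRank_eq lH]; omega
  | m_m_eq hK hH lK lH h => exact .inr ⟨by rw [hK.trailRank_eq lK, hH.trailRank_eq lH], h⟩
  | l_l li lj h => rw [trailRank_get hΓ _ li, trailRank_get hΓ _ lj]; omega
  | c_l li lj h => rw [trailRank_get_comp hΓ _ li, trailRank_get hΓ _ lj]; omega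
  | l_c li lj h => rw [trailRank_get hΓ _ li, trailRank_get_comp hΓ _ lj]; omega
  | c_c li lj h => rw [trailRank_get_comp hΓ _ li, trailRank_get_comp hΓ _ lj]; omega
  | l_m hH li lH h => rw [trailRank_get hΓ _ li, hH.trailRank_eq lH]; omega
  | c_m hH li lH h => rw [trailRank_get_comp hΓ _ li, hH.trailRank_eq lH]; omega
  | m_l hK lK li h => rw [hK.trailRank_eq lK, trailRank_get hΓ _ li]; omega
  | m_c hK lK li h => rw [hK.trailRank_eq lK, trailRank_get_comp hΓ _ li]; omega
  | zero_zero hK hH lK lH h =>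
    rw [trailRank_of_litLevel_eq_zero lK, trailRank_of_litLevel_eq_zero lH]
    exact .inr ⟨rfl, h⟩
  | zero_pos hK hH lK lH =>
    rw [trailRank_of_litLevel_eq_zero lK]
    exact .inl (trailRank_pos lH)
  | undef_undef _ h => exact absurd h hH
  | def_undef _ h => exact absurd h hH

/-- The rank of a literal in the ordering that compares literals by `trailRank` first and by
`≺_T` second. -/
noncomputable def litRank (hwf : WellFounded lt) (Γ : Trail L V) (K : Literal L V) :
    ℕ ×ₗ Ordinal :=
  toLex (trailRank Γ K, ((wellFounded_mulLT hwf).apply K.toMultiset).rank)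

theorem TrailLT.litRank_lt (hwf : WellFounded lt) (hΓ : Trail.Sound lt β Γ)
    (h : TrailLT lt β Γ K H) (hH : ¬ BUndef lt β (Trail.lits Γ) H) :
    litRank hwf Γ K < litRank hwf Γ H := by
  refine Prod.Lex.toLex_lt_toLex.2 ((h.trailRank_lt_or_litLT hΓ hH).imp_right ?_)
  exact And.imp_right fun hlt => Acc.rank_lt_of_rel ((wellFounded_mulLT hwf).apply _) hlt

/-- The rank of a clause in the multiset extension of the ordering given by `litRank`. An ordinal is
used so that clause ranks for different trails live in one type. -/
noncomputable def clauseRank (hwf : WellFounded lt) (Γ : Trail L V) (C : Clause L V) : Ordinal :=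
  (Multiset.wellFounded_isDershowitzMannaLT.apply (C.map (litRank hwf Γ))).rank

theorem clauseRank_lt_of_mulLT (hwf : WellFounded lt) (hΓ : Trail.Sound lt β Γ) {C D : Clause L V}
    (h : MulLT (TrailLT lt β Γ) C D) (hD : ClauseBFalse lt β (Trail.lits Γ) D) :
    clauseRank hwf Γ C < clauseRank hwf Γ D :=
  Acc.rank_lt_of_rel _ <| h.isDershowitzMannaLT_map fun _ K hK hlt =>
    hlt.litRank_lt hwf hΓ ((hD K hK).not_bUndef hwf)

end TrailOrdering

section FalseInstances

variable {L : FirstOrder.Language.{u, v}} {V : Type w} {lt : L.Term V → L.Term V → Prop}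
  {β : L.Term V}

/-- Some clause in `M` has an instance that is `β`-false in `Γ`. -/
def HasFalseInstance (lt : L.Term V → L.Term V → Prop) (β : L.Term V) (M : Set (Clause L V))
    (Γ : Set (Literal L V)) : Prop :=
  ∃ C ∈ M, ∃ τ : Subst L V, ClauseBFalse lt β Γ (Clause.subst C τ)

theorem HasFalseInstance.mono {M M' : Set (Clause L V)} {Γ Γ' : Set (Literal L V)}
    (hM : M ⊆ M') (hΓ : Γ ⊆ Γ') (h : HasFalseInstance lt β M Γ) :
    HasFalseInstance lt β M' Γ' := by
  obtain ⟨C, hC, τ, hτ⟩ := h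
  exact ⟨C, hM hC, τ, hτ.mono hΓ⟩

theorem HasFalseInstance.applicable_conflict {S : State L V} (hlt : IsDesiredTermOrdering lt)
    (hβ : TGround S.β) (hS : S.status = .top)
    (h : HasFalseInstance lt S.β (S.N ∪ S.U) (Trail.lits S.trail)) :
    Applicable lt .conflict S := by
  obtain ⟨C, hC, σ, hσ⟩ := h
  obtain ⟨τ, hτ, hστ⟩ := exists_irreducibleSubst hlt (Trail.lits S.trail) σ
  have hfalse := hσ.subst_of_reflTransGen hlt hστ
  exact ⟨_, hS, C, τ, hC, hfalse.ground hlt hβ, hfalse, hτ, rfl⟩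

theorem exists_becomesFalse (hlt : IsDesiredTermOrdering lt) (hβ : TGround β) {C : Clause L V}
    {τ : Subst L V} (h₀ : ¬ ClauseBFalse lt β ∅ (Clause.subst C τ)) (Γ : Trail L V)
    (h : ClauseBFalse lt β (Trail.lits Γ) (Clause.subst C τ)) :
    ∃ Δ b, Δ ++ [b] <+: Γ ∧ BecomesFalse lt β Δ b C := by
  induction Γ using List.reverseRecOn with
  | nil =>
    refine absurd (h.mono ?_) h₀
    rintro _ ⟨a, ha, -⟩
    exact absurd ha List.not_mem_nil
  | append_singleton Γ a ih =>
    by_cases hΓ : ClauseBFalse lt β (Trail.lits Γ) (Clause.subst C τ)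
    · obtain ⟨Δ, b, hΔ, hb⟩ := ih hΓ
      exact ⟨Δ, b, hΔ.trans (List.prefix_append Γ [a]), hb⟩
    · exact ⟨Γ, a, List.prefix_rfl, τ, h.ground hlt hβ, h, hΓ⟩

end FalseInstances

section Transitions

variable {L : FirstOrder.Language.{u, v}} {V : Type w} {lt : L.Term V → L.Term V → Prop}
  {S T : State L V} {r : Rule} {a : AnnLit L V}

theorem IsReductionChainApp.isLitNormalForm {Γ : Trail L V} {P : List (RewriteStep L V)}
    {I : RewriteStep L V} (h : IsReductionChainApp lt Γ a P) (hI : P.getLast? = some I) :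
    IsLitNormalForm (conv lt (Trail.lits Γ)) a.lit (I.lead.subst I.sub) := by
  obtain ⟨⟨-, I', hI', hn⟩, -⟩ := h
  rwa [Option.some.inj (hI.symm.trans hI')]

theorem PropagateStep.exists_isLitNormalForm (hwf : WellFounded lt)
    (h : PropagateStep lt S T a) : ∃ K, LitBelow lt S.β K ∧ ¬ Defined (Trail.lits S.trail) K ∧
      IsLitNormalForm (conv lt (Trail.lits S.trail)) K a.lit := by
  obtain ⟨-, C₀, C₁, K, σ, μ, P, I, -, -, -, -, hμ, hundef, hbelow, -, hP, hI, rfl, -⟩ := h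
  have hμσ : Literal.subst (Literal.subst K μ) σ = K.subst σ := by
    rw [Literal.subst_subst, hμ.comp_eq]
  have hK : LitBelow lt S.β (K.subst σ) := by
    refine clauseBelow_iff.1 hbelow _ ?_
    simp [Clause.subst, hμσ]
  exact ⟨K.subst σ, hK, hundef.resolve_left (hK.not_litAbove hwf), hμσ ▸ hP.isLitNormalForm hI⟩

theorem DecideStep.exists_isLitNormalForm (hwf : WellFounded lt) (h : DecideStep lt S T a) :
    ∃ K, LitBelow lt S.β K ∧ ¬ Defined (Trail.lits S.trail) K ∧
      IsLitNormalForm (conv lt (Trail.lits S.trail)) K a.lit := by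
  obtain ⟨-, C₀, K, σ, P, I, -, -, -, hundef, hbelow, -, hP, hI, rfl, -⟩ := h
  have hK : LitBelow lt S.β (K.subst σ) := clauseBelow_iff.1 hbelow _ (by simp [Clause.subst])
  exact ⟨K.subst σ, hK, hundef.resolve_left (hK.not_litAbove hwf), hP.isLitNormalForm hI⟩

theorem DecideStep.litBelow (hlt : IsDesiredTermOrdering lt) (h : DecideStep lt S T a) :
    LitBelow lt S.β a.lit := by
  obtain ⟨K, hK, -, hn⟩ := h.exists_isLitNormalForm hlt.wellFounded
  exact hn.litReduces.litBelow hlt hK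

theorem DecideStep.not_defined (hlt : IsDesiredTermOrdering lt) (h : DecideStep lt S T a) :
    ¬ Defined (Trail.lits S.trail) a.lit := by
  obtain ⟨K, -, hK, hn⟩ := h.exists_isLitNormalForm hlt.wellFounded
  exact hn.litReduces.defined_iff.not.1 hK

theorem DecideStep.eq (h : DecideStep lt S T a) :
    T = { S with trail := S.trail ++ [a], k := a.level } := by
  obtain ⟨-, _, _, _, _, _, -, -, -, -, -, -, -, -, rfl, rfl⟩ := h
  rfl

/-- The effect of a rule application on a state, reduced to what the termination argument needs:
Propagate and Decide become `extend`, and Explore-Refutation, Factorize and Equality-Resolution,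
which only replace the conflict closure by a smaller one, become `simplify`. -/
inductive Transition (lt : L.Term V → L.Term V → Prop) (S : State L V) : Rule → State L V → Prop
  | extend (r : Rule) (a : AnnLit L V) (k : ℕ) (hr : r = .propagate ∨ r = .decide)
      (hS : S.status = .top) (hbelow : LitBelow lt S.β a.lit)
      (hundef : ¬ Defined (Trail.lits S.trail) a.lit) :
      Transition lt S r { S with trail := S.trail ++ [a], k := k }
  | conflict (D : Status L V) (hS : S.status = .top) (hD : D ≠ .top)
      (hfalse : ∀ C σ, D = .conflict C σ →
        ClauseBFalse lt S.β (Trail.lits S.trail) (Clause.subst C σ)) :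
      Transition lt S .conflict { S with status := D }
  | skip (Γ : Trail L V) (a : AnnLit L V) (k : ℕ) (C : Clause L V) (σ : Subst L V)
      (hΓ : S.trail = Γ ++ [a]) (hS : S.status = .conflict C σ)
      (hfalse : ClauseBFalse lt S.β (Trail.lits Γ) (Clause.subst C σ)) :
      Transition lt S .skip { S with trail := Γ, k := k }
  | simplify (r : Rule) (C D : Clause L V) (σ τ : Subst L V)
      (hr : r = .exploreRefutation ∨ r = .factorize ∨ r = .equalityResolution)
      (hS : S.status = .conflict C σ)
      (hfalse : ClauseBFalse lt S.β (Trail.lits S.trail) (Clause.subst C σ) →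
        ClauseBFalse lt S.β (Trail.lits S.trail) (Clause.subst D τ))
      (hless : MulLT (TrailLT lt S.β S.trail) (Clause.subst D τ) (Clause.subst C σ)) :
      Transition lt S r { S with status := .conflict D τ }
  | backtrack (Γ : Trail L V) (a : AnnLit L V) (k : ℕ) (C : Clause L V) (σ : Subst L V)
      (hΓ : Γ ++ [a] <+: S.trail) (hS : S.status = .conflict C σ)
      (hmin : ∀ Δ b, Δ ++ [b] <+: S.trail → BecomesFalse lt S.β Δ b C → Γ.length ≤ Δ.length) :
      Transition lt S .backtrack
        { S with trail := Γ, U := S.U ∪ {C}, k := k, status := .top }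
  | grow (β : L.Term V) (hS : S.status = .top) (hβ : TGround β) :
      Transition lt S .grow { S with trail := [], β := β, k := 0 }

theorem PropagateStep.transition (hlt : IsDesiredTermOrdering lt) (h : PropagateStep lt S T a) :
    Transition lt S .propagate T := by
  obtain ⟨K, hbelow, hundef, hn⟩ := h.exists_isLitNormalForm hlt.wellFounded
  obtain ⟨hS, -, -, -, -, -, -, -, -, -, -, -, -, -, -, -, -, -, -, rfl⟩ := h
  exact .extend _ a S.k (.inl rfl) hS (hn.litReduces.litBelow hlt hbelow)
    (hn.litReduces.defined_iff.not.1 hundef)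

theorem DecideStep.transition (hlt : IsDesiredTermOrdering lt) (h : DecideStep lt S T a) :
    Transition lt S .decide T := by
  have hbelow := h.litBelow hlt
  have hundef := h.not_defined hlt
  obtain ⟨hS, -, -, -, -, -, -, -, -, -, -, -, -, -, -, rfl⟩ := h
  exact .extend _ a (S.k + 1) (.inr rfl) hS hbelow hundef

theorem ConflictStep.transition (h : ConflictStep lt S T) : Transition lt S .conflict T := by
  obtain ⟨hS, D, σ, -, -, hfalse, -, rfl⟩ := h
  split_ifs
  · exact .conflict _ hS (by simp) (by simp)
  · refine .conflict _ hS (by simp) fun D' σ' h => ?_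
    obtain ⟨rfl, rfl⟩ : D = D' ∧ σ = σ' := by simpa using h
    exact hfalse

theorem SkipStep.transition (h : SkipStep lt S T) : Transition lt S .skip T := by
  obtain ⟨Γ, a, b, D, σ, hΓ, hS, hfalse, rfl⟩ := h
  exact .skip (Γ ++ [a]) b _ D σ (by simp [hΓ]) hS hfalse

theorem ExploreRefutationStep.transition (h : ExploreRefutationStep lt S T) :
    Transition lt S .exploreRefutation T := by
  obtain ⟨D, K, σ, i, P, I, hS, -, -, -, -, -, hless, hfalse, rfl⟩ := h
  exact .simplify _ _ _ _ _ (by simp) hS (fun _ => hfalse) hless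

theorem Transition.simplify_of_subst_add (hr : r = .factorize ∨ r = .equalityResolution)
    {C D E : Clause L V} {σ : Subst L V} (hE : E ≠ 0) (hS : S.status = .conflict (D + E) σ)
    (hC : Clause.subst C σ = Clause.subst D σ) :
    Transition lt S r { S with status := .conflict C σ } := by
  have hsplit : Clause.subst (D + E) σ = Clause.subst C σ + Clause.subst E σ := by
    rw [hC]
    exact Multiset.map_add _ D E
  refine .simplify _ _ _ _ _ (.inr hr) hS (ClauseBFalse.of_subset ?_) ?_
  · exact hsplit ▸ Multiset.subset_of_le (Multiset.le_add_right _ _)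
  · exact hsplit ▸ mulLT_add_right (by simpa [Clause.subst] using hE)

theorem FactorizeStep.transition (h : FactorizeStep S T) : Transition lt S .factorize T := by
  obtain ⟨D, K, K', σ, μ, hS, -, hμ, rfl⟩ := h
  refine .simplify_of_subst_add (.inl rfl) (by simp) hS ?_
  rw [Clause.subst_subst, hμ.comp_eq]

theorem EqualityResolutionStep.transition (h : EqualityResolutionStep S T) :
    Transition lt S .equalityResolution T := by
  obtain ⟨D, s, s', σ, μ, hS, hσ, hμ, rfl⟩ := h
  refine .simplify_of_subst_add (.inr rfl) (by simp) hS ?_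
  have hunifies : Unifies σ {(s, s')} := by
    rintro _ rfl
    exact hσ
  rw [Clause.subst_subst, hμ.comp_eq hunifies]

theorem BacktrackStep.transition (h : BacktrackStep lt S T) : Transition lt S .backtrack T := by
  obtain ⟨Γ, Γ', a, D, K, σ, hΓ, hS, -, -, hmin, rfl⟩ := h
  exact .backtrack Γ a _ _ _ ⟨Γ', hΓ.symm⟩ hS fun Δ b ⟨Δ', hΔ⟩ => hmin Δ Δ' b hΔ.symm

theorem GrowStep.transition (h : GrowStep lt S T) : Transition lt S .grow T := by
  obtain ⟨hS, β, hβ, -, rfl⟩ := h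
  exact .grow β hS hβ

theorem Step.transition (hlt : IsDesiredTermOrdering lt) (h : Step lt r S T) :
    Transition lt S r T := by
  cases r with
  | propagate => exact PropagateStep.transition hlt h.choose_spec
  | decide => exact DecideStep.transition hlt h.choose_spec
  | conflict => exact ConflictStep.transition h
  | skip => exact SkipStep.transition h
  | exploreRefutation => exact ExploreRefutationStep.transition h
  | factorize => exact FactorizeStep.transition h
  | equalityResolution => exact EqualityResolutionStep.transition h
  | backtrack => exact BacktrackStep.transition h
  | grow => exact GrowStep.transition h

theorem Transition.N_eq (h : Transition lt S r T) : T.N = S.N := by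
  cases h <;> rfl

theorem Transition.β_eq (h : Transition lt S r T) (hr : r ≠ .grow) : T.β = S.β := by
  cases h <;> first | rfl | exact absurd rfl hr

theorem Transition.clauses_subset (h : Transition lt S r T) : S.N ∪ S.U ⊆ T.N ∪ T.U := by
  rw [h.N_eq]
  refine Set.union_subset_union_right _ ?_
  cases h with
  | backtrack => exact Set.subset_union_left
  | _ => exact subset_rfl

end Transitions

section Invariants

variable {L : FirstOrder.Language.{u, v}} {V : Type w} {lt : L.Term V → L.Term V → Prop}
  {S T : State L V} {r : Rule}

/-- The invariant of all runs: the bound `β` is ground, the trail is sound, and the conflict closure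
is `β`-false in the trail. -/
structure State.Inv (lt : L.Term V → L.Term V → Prop) (S : State L V) : Prop where
  ground : TGround S.β
  sound : Trail.Sound lt S.β S.trail
  conflict_false : ∀ C σ, S.status = .conflict C σ →
    ClauseBFalse lt S.β (Trail.lits S.trail) (Clause.subst C σ)

theorem Transition.inv (h : Transition lt S r T) (hS : S.Inv lt) : T.Inv lt := by
  cases h with
  | extend _ a k hr hst hbelow hundef =>
    exact ⟨hS.ground, hS.sound.append_singleton hbelow hundef, by simp [hst]⟩
  | conflict D hst hD hfalse => exact ⟨hS.ground, hS.sound, hfalse⟩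
  | skip Γ a k C σ hΓ hst hfalse =>
    refine ⟨hS.ground, hS.sound.of_prefix (hΓ ▸ List.prefix_append Γ [a]), fun C' σ' h => ?_⟩
    obtain ⟨rfl, rfl⟩ : C = C' ∧ σ = σ' := by simpa [hst] using h
    exact hfalse
  | simplify _ C D σ τ hr hst hfalse hless =>
    refine ⟨hS.ground, hS.sound, fun D' τ' h => ?_⟩
    obtain ⟨rfl, rfl⟩ : D = D' ∧ τ = τ' := by simpa using h
    exact hfalse (hS.conflict_false C σ hst)
  | backtrack Γ a k C σ hΓ hst hmin =>
    exact ⟨hS.ground, hS.sound.of_prefix ((List.prefix_append Γ [a]).trans hΓ), by simp⟩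
  | grow β hst hβ => exact ⟨hβ, Trail.sound_nil, by simp [hst]⟩

/-- The invariant of runs in which Conflict has precedence: unless it has one in the empty trail, no
clause has a `β`-false instance in a proper prefix of the trail. -/
def State.PrefixInv (lt : L.Term V → L.Term V → Prop) (S : State L V) : Prop :=
  ¬ HasFalseInstance lt S.β (S.N ∪ S.U) ∅ →
    ∀ Δ b, Δ ++ [b] <+: S.trail → ¬ HasFalseInstance lt S.β (S.N ∪ S.U) (Trail.lits Δ)

theorem Transition.prefixInv (hlt : IsDesiredTermOrdering lt) (h : Transition lt S r T)
    (hβ : TGround S.β) (hprec : r = .propagate ∨ r = .decide → ¬ Applicable lt .conflict S)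
    (hS : S.PrefixInv lt) : T.PrefixInv lt := by
  intro h₀ Δ c hΔ
  cases h with
  | extend _ a k hr hst hbelow hundef =>
    rcases List.prefix_concat_iff.1 hΔ with hΔ | hΔ
    · obtain ⟨rfl, rfl⟩ := List.append_singleton_inj.1 hΔ
      exact fun hf => hprec hr (hf.applicable_conflict hlt hβ hst)
    · exact hS h₀ Δ c hΔ
  | conflict D hst hD hfalse => exact hS h₀ Δ c hΔ
  | skip Γ a k C σ hΓ hst hfalse =>
    exact hS h₀ Δ c (hΔ.trans (hΓ ▸ List.prefix_append Γ [a]))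
  | simplify _ C D σ τ hr hst hfalse hless => exact hS h₀ Δ c hΔ
  | backtrack Γ a k C σ hΓ hst hmin =>
    have hΔS : Δ ++ [c] <+: S.trail := hΔ.trans ((List.prefix_append Γ [a]).trans hΓ)
    rintro ⟨E, hE, τ, hτ⟩
    rw [← Set.union_assoc] at hE
    rcases hE with hE | rfl
    · refine hS (fun hf => h₀ ?_) Δ c hΔS ⟨E, hE, τ, hτ⟩
      exact hf.mono (Set.union_subset_union_right _ Set.subset_union_left) le_rfl
    · obtain ⟨Δ', b, hΔ', hb⟩ := exists_becomesFalse hlt hβ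
        (fun hf => h₀ ⟨E, .inr (.inr rfl), τ, hf⟩) Δ hτ
      have hmin' := hmin Δ' b (hΔ'.trans ((List.prefix_append Δ [c]).trans hΔS)) hb
      have hlen := hΔ.length_le
      have hlen' := hΔ'.length_le
      simp only [List.length_append, List.length_singleton] at hlen hlen'
      omega
  | grow β hst hβ => exact absurd (List.prefix_nil.1 hΔ) (by simp)

end Invariants

section Profiles

variable {L : FirstOrder.Language.{u, v}} {V : Type w} {lt : L.Term V → L.Term V → Prop}
  {β : L.Term V}

/-- The literals of a clause, and those that occur in it exactly once. Below a bound there are only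
finitely many profiles, whereas there are infinitely many clauses because of repeated literals. -/
def Clause.profile (C : Clause L V) : Set (Literal L V) × Set (Literal L V) :=
  ({K | K ∈ C}, {K | ∃ D : Clause L V, C = K ::ₘ D ∧ K ∉ D})

/-- The profiles of the instances below `β` of the clauses in `M`. -/
def profiles (lt : L.Term V → L.Term V → Prop) (β : L.Term V) (M : Set (Clause L V)) :
    Set (Set (Literal L V) × Set (Literal L V)) :=
  {p | ∃ C ∈ M, ∃ τ : Subst L V, (∀ K ∈ Clause.subst C τ, LitBelow lt β K) ∧
    Clause.profile (Clause.subst C τ) = p}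

theorem profiles_mono {M M' : Set (Clause L V)} (h : M ⊆ M') :
    profiles lt β M ⊆ profiles lt β M' := by
  rintro p ⟨C, hC, h'⟩
  exact ⟨C, h hC, h'⟩

theorem profiles_subset (M : Set (Clause L V)) :
    profiles lt β M ⊆ 𝒫 {K | LitBelow lt β K} ×ˢ 𝒫 {K | LitBelow lt β K} := by
  rintro p ⟨C, -, τ, h, rfl⟩
  refine ⟨h, ?_⟩
  rintro K ⟨D, hD, -⟩
  exact h K (hD ▸ Multiset.mem_cons_self K D)

theorem finite_powerset_litBelow_prod (hlt : IsDesiredTermOrdering lt) (hβ : TGround β) :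
    (𝒫 {K : Literal L V | LitBelow lt β K} ×ˢ 𝒫 {K : Literal L V | LitBelow lt β K}).Finite :=
  (finite_litBelow hlt hβ).finite_subsets.prod (finite_litBelow hlt hβ).finite_subsets

theorem ClauseBFalse.profile_notMem {M : Set (Clause L V)} {Γ : Set (Literal L V)}
    {C : Clause L V} (hC : ClauseBFalse lt β Γ C) (hM : ¬ HasFalseInstance lt β M Γ) :
    Clause.profile C ∉ profiles lt β M := by
  rintro ⟨D, hD, τ, -, hp⟩
  exact hM ⟨D, hD, τ, hC.of_subset (Set.ext_iff.1 (congrArg Prod.fst hp) · |>.1)⟩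

theorem Clause.exists_eq_cons_of_profile_eq {C D : Clause L V} {K : Literal L V}
    (h : Clause.profile C = Clause.profile (K ::ₘ D)) (hK : K ∉ D) :
    ∃ E : Clause L V, C = K ::ₘ E ∧ E ⊆ D := by
  have hsupport := Set.ext_iff.1 (congrArg Prod.fst h)
  obtain ⟨E, rfl, hE⟩ := (Set.ext_iff.1 (congrArg Prod.snd h) K).2 ⟨D, rfl, hK⟩
  refine ⟨E, rfl, fun H hH => ?_⟩
  refine (Multiset.mem_cons.1 ((hsupport H).1 (Multiset.mem_cons_of_mem hH))).resolve_left ?_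
  rintro rfl
  exact hE hH

end Profiles

section Decisions

variable {L : FirstOrder.Language.{u, v}} {V : Type w} {lt : L.Term V → L.Term V → Prop}
  {S T : State L V} {a : AnnLit L V}

theorem isReductionChainApp_leaf {Γ : Trail L V}
    (h : ∀ t ∈ a.lit.eqn, Irreducible (conv lt (Trail.lits Γ)) t) :
    IsReductionChainApp lt Γ a [.leaf a.lead a.rest a.sub] := by
  refine ⟨⟨fun i => .inl ⟨a, by simp, by simp⟩, _, rfl, isLitNormalForm_self h⟩, ?_⟩
  rintro i hi ⟨-, I, hI, -⟩
  obtain rfl : i = 0 := by simpa using hi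
  simp at hI

theorem propagateStep_of_clauseBFalse (hlt : IsDesiredTermOrdering lt) (hβ : TGround S.β)
    (hS : S.status = .top) {K : Literal L V} {C : Clause L V} {τ : Subst L V}
    (hC : K ::ₘ C ∈ S.N ∪ S.U) (hτ : IrreducibleSubst (conv lt (Trail.lits S.trail)) τ)
    (hbelow : LitBelow lt S.β (K.subst τ)) (hundef : ¬ Defined (Trail.lits S.trail) (K.subst τ))
    (hirr : ∀ t ∈ (K.subst τ).eqn, Irreducible (conv lt (Trail.lits S.trail)) t)
    (hfalse : ClauseBFalse lt S.β (Trail.lits S.trail) (Clause.subst C τ)) :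
    PropagateStep lt S { S with trail := S.trail ++ [⟨S.k, K, C, τ⟩] } ⟨S.k, K, C, τ⟩ := by
  have hall : ∀ H ∈ Clause.subst (C + {K}) τ, LitBelow lt S.β H := by
    intro H hH
    obtain ⟨H, hHCK, rfl⟩ := Multiset.mem_map.1 hH
    rcases Multiset.mem_add.1 hHCK with hHC | hHK
    · exact (hfalse _ (Multiset.mem_map_of_mem _ hHC)).1
    · rwa [Multiset.mem_singleton.1 hHK]
  refine ⟨hS, C, 0, K, τ, Term.var, [.leaf K C τ], .leaf K C τ, ?_, ?_, ?_, by simp,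
    isLitMgu_zero τ K, .inr hundef, ?_, hτ, ?_, rfl, rfl, rfl⟩
  · rwa [add_zero, add_comm, Multiset.singleton_add]
  · rw [add_zero]
    exact Clause.ground_iff.2 fun H hH => (hall H hH).ground hlt hβ
  · exact fun H hH => (hfalse H hH).2
  · rw [Clause.subst_var]
    exact clauseBelow_iff.2 hall
  · rw [Literal.subst_var, Clause.subst_var]
    exact isReductionChainApp_leaf (a := ⟨S.k, K, C, τ⟩) hirr

theorem DecideStep.exists_propagateStep (hlt : IsDesiredTermOrdering lt) (hβ : TGround S.β)
    (h : DecideStep lt S T a) {K : Literal L V} {C : Clause L V} {σ : Subst L V}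
    (hC : K ::ₘ C ∈ S.N ∪ S.U) (hK : K.subst σ = a.lit.comp)
    (hfalse : ClauseBFalse lt S.β (Trail.lits S.trail) (Clause.subst C σ)) :
    ∃ T' b, PropagateStep lt S T' b ∧ b.clause = K ::ₘ C ∧ b.lit = a.lit.comp := by
  obtain ⟨H, -, -, hn⟩ := h.exists_isLitNormalForm hlt.wellFounded
  obtain ⟨τ, hτ, hστ⟩ := exists_irreducibleSubst hlt (Trail.lits S.trail) σ
  have hKτ : K.subst τ = a.lit.comp := by
    rw [← hK]
    refine (litReduces_subst K hστ).eq_of_irreducible ?_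
    rw [hK]
    exact hn.irreducible
  refine ⟨_, ⟨S.k, K, C, τ⟩, propagateStep_of_clauseBFalse hlt hβ h.1 hC hτ ?_ ?_ ?_
    (hfalse.subst_of_reflTransGen hlt hστ), rfl, hKτ⟩
  · exact hKτ ▸ (h.litBelow hlt).comp
  · rw [hKτ, defined_comp_iff]
    exact h.not_defined hlt
  · rw [hKτ]
    exact hn.irreducible

theorem DecideStep.clauseBFalse_of_clauseLevel_lt (hlt : IsDesiredTermOrdering lt)
    (h : DecideStep lt S T a) {C : Clause L V}
    (hC : ClauseBFalse lt S.β (Trail.lits (S.trail ++ [a])) C)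
    (hl : clauseLevel (S.trail ++ [a]) C < a.level) :
    ClauseBFalse lt S.β (Trail.lits S.trail) C ∧ a.lit.comp ∉ C := by
  have hdef : ∀ K ∈ C, Defined (Trail.lits S.trail) K := fun K hK =>
    defined_of_litLevel_lt (.inr (hC K hK).2) ((litLevel_le_clauseLevel hK).trans_lt hl)
  refine ⟨fun K hK => ⟨(hC K hK).1, ?_⟩, fun ha => ?_⟩
  · refine entails_of_entails_insert (h.not_defined hlt) (defined_comp_iff.2 (hdef K hK)) ?_
    exact Trail.lits_append_singleton S.trail a ▸ (hC K hK).2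
  · exact h.not_defined hlt (defined_comp_iff.1 (hdef _ ha))

theorem DecideStep.profile_notMem (hlt : IsDesiredTermOrdering lt) (hβ : TGround S.β)
    (h : DecideStep lt S T a)
    (hno : ∀ (T' : State L V) (b : AnnLit L V), PropagateStep lt S T' b →
      b.clause ∈ S.N ∪ S.U → a.lit ≠ b.lit.comp)
    {C : Clause L V} {H : Literal L V}
    (hC : ClauseBFalse lt S.β (Trail.lits (S.trail ++ [a])) (C + {H}))
    (hl : clauseLevel (S.trail ++ [a]) C < a.level) (hmem : a.lit.comp ∈ C + {H}) :
    Clause.profile (C + {H}) ∉ profiles lt S.β (S.N ∪ S.U) := by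
  classical
  obtain ⟨hfalse, ha⟩ := h.clauseBFalse_of_clauseLevel_lt hlt
    (hC.of_subset (Multiset.subset_of_le (Multiset.le_add_right C {H}))) hl
  obtain rfl := Multiset.mem_singleton.1 ((Multiset.mem_add.1 hmem).resolve_left ha)
  rw [add_comm, Multiset.singleton_add]
  rintro ⟨D, hD, τ, -, hp⟩
  obtain ⟨E, hE, hEC⟩ := Clause.exists_eq_cons_of_profile_eq hp ha
  obtain ⟨K, hK, hKτ, rfl⟩ := (Multiset.map_eq_cons _ _ _ _).2 hE
  have hDcons := Multiset.cons_erase hK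
  obtain ⟨T', b, hstep, hb, hba⟩ := h.exists_propagateStep hlt hβ (hDcons.symm ▸ hD) hKτ
    (hfalse.of_subset hEC)
  exact hno T' b hstep ((hb.trans hDcons).symm ▸ hD) (by rw [hba, Literal.comp_comp])

end Decisions

section Measure

variable {L : FirstOrder.Language.{u, v}} {V : Type w} {lt : L.Term V → L.Term V → Prop}
  {S T : State L V} {r : Rule}

/-- The measure that decreases in all steps other than Backtrack and Grow. Before a conflict the
trail grows towards its maximal length; in a conflict state first the trail and then the rank of the
conflict closure gets smaller. -/
noncomputable def State.measure (hwf : WellFounded lt) (S : State L V) : ℕ ×ₗ ℕ ×ₗ Ordinal :=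
  match S.status with
  | .top => toLex (2, toLex
      ({K : Literal L V | LitBelow lt S.β K}.ncard - List.length S.trail, 0))
  | .conflict C σ => toLex (1, toLex
      (List.length S.trail, clauseRank hwf S.trail (Clause.subst C σ)))
  | .bot => toLex (0, toLex (0, 0))

theorem Transition.measure_lt (hlt : IsDesiredTermOrdering lt) (h : Transition lt S r T)
    (hS : S.Inv lt) (hb : r ≠ .backtrack) (hg : r ≠ .grow) :
    T.measure hlt.wellFounded < S.measure hlt.wellFounded := by
  have hT := h.inv hS
  cases h with
  | extend _ a k hr hst hbelow hundef =>
    have hlen := hT.sound.length_le hlt hT.ground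
    simp only [List.length_append, List.length_singleton] at hlen
    simp only [State.measure, hst, Prod.Lex.toLex_lt_toLex, List.length_append,
      List.length_singleton]
    exact .inr ⟨trivial, .inl (by omega)⟩
  | conflict D hst hD hfalse =>
    cases D with
    | top => exact absurd rfl hD
    | bot => simp [State.measure, hst, Prod.Lex.toLex_lt_toLex]
    | conflict C σ => simp [State.measure, hst, Prod.Lex.toLex_lt_toLex]
  | skip Γ a k C σ hΓ hst hfalse =>
    simp [State.measure, hst, hΓ, Prod.Lex.toLex_lt_toLex]
  | simplify _ C D σ τ hr hst hfalse hless =>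
    have hrank := clauseRank_lt_of_mulLT hlt.wellFounded hS.sound hless
      (hS.conflict_false C σ hst)
    simp [State.measure, hst, Prod.Lex.toLex_lt_toLex, hrank]
  | backtrack => exact absurd rfl hb
  | grow => exact absurd rfl hg

/-- The profiles below `β` that no instance of a clause in `N ∪ U` has. -/
def State.missingProfiles (lt : L.Term V → L.Term V → Prop) (S : State L V) :
    Set (Set (Literal L V) × Set (Literal L V)) :=
  (𝒫 {K | LitBelow lt S.β K} ×ˢ 𝒫 {K | LitBelow lt S.β K}) \ profiles lt S.β (S.N ∪ S.U)

theorem State.finite_missingProfiles (hlt : IsDesiredTermOrdering lt) (hβ : TGround S.β) :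
    (S.missingProfiles lt).Finite :=
  (finite_powerset_litBelow_prod hlt hβ).sdiff

theorem Transition.missingProfiles_subset (h : Transition lt S r T) (hr : r ≠ .grow) :
    T.missingProfiles lt ⊆ S.missingProfiles lt := by
  unfold State.missingProfiles
  rw [h.β_eq hr]
  exact Set.sdiff_subset_sdiff_right (profiles_mono h.clauses_subset)

end Measure

section ConflictAnalysis

variable {L : FirstOrder.Language.{u, v}} {V : Type w} {lt : L.Term V → L.Term V → Prop}
  {S T : State L V} {r : Rule}

/-- The rules from Conflict up to the next Backtrack. -/
def Rule.IsConflictRule : Rule → Prop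
  | .conflict | .skip | .exploreRefutation | .factorize | .equalityResolution => True
  | .propagate | .decide | .backtrack | .grow => False

theorem Transition.isConflictRule (h : Transition lt S r T) {C : Clause L V} {σ : Subst L V}
    (hT : T.status = .conflict C σ) :
    r.IsConflictRule ∧ (r ≠ .conflict → ∃ D τ, S.status = .conflict D τ) := by
  cases h with
  | extend _ a k hr hst hbelow hundef => simp [hst] at hT
  | conflict D hst hD hfalse => exact ⟨trivial, fun h => absurd rfl h⟩
  | skip Γ a k D τ hΓ hst hfalse => exact ⟨trivial, fun _ => ⟨D, τ, hst⟩⟩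
  | simplify _ D E τ τ' hr hst hfalse hless =>
    exact ⟨by rcases hr with rfl | rfl | rfl <;> trivial, fun _ => ⟨D, τ, hst⟩⟩
  | backtrack => simp at hT
  | grow β hst hβ => simp [hst] at hT

theorem Transition.of_isConflictRule (h : Transition lt S r T) (hr : r.IsConflictRule) :
    T.β = S.β ∧ T.N ∪ T.U = S.N ∪ S.U ∧ T.trail <+: S.trail := by
  cases h with
  | extend _ a k hr' => rcases hr' with rfl | rfl <;> exact hr.elim
  | skip Γ a k C σ hΓ hst hfalse => exact ⟨rfl, rfl, hΓ ▸ List.prefix_append Γ [a]⟩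
  | backtrack => exact hr.elim
  | grow => exact hr.elim
  | _ => exact ⟨rfl, rfl, List.prefix_rfl⟩

theorem Transition.trail_eq_of_ne_skip (h : Transition lt S r T) (hr : r.IsConflictRule)
    (hskip : r ≠ .skip) : T.trail = S.trail ∧ T.k = S.k := by
  cases h with
  | extend _ a k hr' => rcases hr' with rfl | rfl <;> exact hr.elim
  | skip => exact absurd rfl hskip
  | backtrack => exact hr.elim
  | grow => exact hr.elim
  | _ => exact ⟨rfl, rfl⟩

theorem Transition.trail_append_of_skip (h : Transition lt S .skip T) :
    ∃ a, S.trail = T.trail ++ [a] := by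
  generalize hr : Rule.skip = r at h
  cases h with
  | skip Γ a k C σ hΓ hst hfalse => exact ⟨a, hΓ⟩
  | extend _ a k hr' => simp [← hr] at hr'
  | simplify _ C D σ τ hr' => simp [← hr] at hr'
  | _ => simp at hr

theorem Transition.status_eq_top (h : Transition lt S r T)
    (hr : r = .propagate ∨ r = .decide) : S.status = .top := by
  rcases hr with rfl | rfl <;> cases h <;> simp_all

theorem Transition.length_trail_le (h : Transition lt S r T) (hp : r ≠ .propagate)
    (hd : r ≠ .decide) : List.length T.trail ≤ List.length S.trail := by
  cases h with
  | extend _ a k hr => exact absurd hr (by simp [hp, hd])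
  | skip Γ a k C σ hΓ hst hfalse => simp [hΓ]
  | backtrack Γ a k C σ hΓ hst hmin => exact ((List.prefix_append Γ [a]).trans hΓ).length_le
  | grow => exact Nat.zero_le _
  | _ => exact le_rfl

theorem Transition.length_trail_lt_of_backtrack (h : Transition lt S .backtrack T) :
    List.length T.trail < List.length S.trail := by
  generalize hr : Rule.backtrack = r at h
  cases h with
  | backtrack Γ a k C σ hΓ hst hmin => simpa using hΓ.length_le
  | extend _ a k hr' => simp [← hr] at hr'
  | simplify _ C D σ τ hr' => simp [← hr] at hr'
  | _ => simp at hr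

end ConflictAnalysis

section Runs

variable {L : FirstOrder.Language.{u, v}} {V : Type w} {lt : L.Term V → L.Term V → Prop}
  {β : L.Term V} {N : Set (Clause L V)} {n : ℕ∞} {s : ℕ → State L V} {r : ℕ → Rule} {i j : ℕ}

theorem IsRun.transition (hlt : IsDesiredTermOrdering lt) (h : IsRun lt N β n s r)
    (hi : (i : ℕ∞) < n) : Transition lt (s i) (r i) (s (i + 1)) :=
  (h.2 i hi).transition hlt

theorem IsRun.inv (hlt : IsDesiredTermOrdering lt) (hβ : TGround β) (h : IsRun lt N β n s r)
    (hi : (i : ℕ∞) ≤ n) : (s i).Inv lt := by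
  induction i with
  | zero => exact h.1 ▸ ⟨hβ, Trail.sound_nil, by simp [initialState]⟩
  | succ i ih =>
    have hin : (i : ℕ∞) < n := ENat.natCast_add_one_le_iff.1 (by exact_mod_cast hi)
    exact (h.transition hlt hin).inv (ih hin.le)

theorem IsRun.exists_last_conflict (hlt : IsDesiredTermOrdering lt) (h : IsRun lt N β n s r)
    (hi : (i : ℕ∞) ≤ n) {C : Clause L V} {σ : Subst L V} (hC : (s i).status = .conflict C σ) :
    ∃ j < i, r j = .conflict ∧ (∀ l, j < l → l < i → r l ≠ .conflict) ∧
      ∀ l ∈ Set.Ico j i, (r l).IsConflictRule := by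
  induction i generalizing C σ with
  | zero => simp [h.1, initialState] at hC
  | succ i ih =>
    have hin : (i : ℕ∞) < n := ENat.natCast_add_one_le_iff.1 (by exact_mod_cast hi)
    obtain ⟨hrule, hprev⟩ := (h.transition hlt hin).isConflictRule hC
    by_cases hri : r i = .conflict
    · refine ⟨i, i.lt_succ_self, hri, fun l hil hl => by omega, fun l hl => ?_⟩
      rwa [show l = i by grind]
    · obtain ⟨D, τ, hD⟩ := hprev hri
      obtain ⟨j, hj, hrj, hlast, hrules⟩ := ih hin.le hD
      refine ⟨j, hj.trans i.lt_succ_self, hrj, fun l hjl hl => ?_, fun l hl => ?_⟩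
      · rcases Nat.lt_succ_iff_lt_or_eq.1 hl with hl | rfl
        exacts [hlast l hjl hl, hri]
      · rcases Nat.lt_succ_iff_lt_or_eq.1 hl.2 with hli | rfl
        exacts [hrules l ⟨hl.1, hli⟩, hrule]

theorem IsRun.of_isConflictRule (hlt : IsDesiredTermOrdering lt) (h : IsRun lt N β n s r)
    (hi : (i : ℕ∞) ≤ n) (hji : j ≤ i) (hr : ∀ l ∈ Set.Ico j i, (r l).IsConflictRule) :
    (s i).β = (s j).β ∧ (s i).N ∪ (s i).U = (s j).N ∪ (s j).U ∧ (s i).trail <+: (s j).trail := by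
  induction i, hji using Nat.le_induction with
  | base => exact ⟨rfl, rfl, List.prefix_rfl⟩
  | succ i hji ih =>
    have hin : (i : ℕ∞) < n := ENat.natCast_add_one_le_iff.1 (by exact_mod_cast hi)
    obtain ⟨hβ, hU, htrail⟩ := (h.transition hlt hin).of_isConflictRule (hr i ⟨hji, by simp⟩)
    obtain ⟨hβ', hU', htrail'⟩ := ih hin.le fun l hl => hr l ⟨hl.1, hl.2.trans i.lt_succ_self⟩
    exact ⟨hβ.trans hβ', hU.trans hU', htrail.trans htrail'⟩

theorem IsRun.trail_eq_of_ne_skip (hlt : IsDesiredTermOrdering lt) (h : IsRun lt N β n s r)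
    (hi : (i : ℕ∞) ≤ n) (hji : j ≤ i) (hr : ∀ l ∈ Set.Ico j i, (r l).IsConflictRule)
    (hskip : ∀ l ∈ Set.Ico j i, r l ≠ .skip) :
    (s i).trail = (s j).trail ∧ (s i).k = (s j).k := by
  induction i, hji using Nat.le_induction with
  | base => exact ⟨rfl, rfl⟩
  | succ i hji ih =>
    have hin : (i : ℕ∞) < n := ENat.natCast_add_one_le_iff.1 (by exact_mod_cast hi)
    obtain ⟨htrail, hk⟩ := (h.transition hlt hin).trail_eq_of_ne_skip (hr i ⟨hji, by simp⟩)
      (hskip i ⟨hji, by simp⟩)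
    obtain ⟨htrail', hk'⟩ := ih hin.le (fun l hl => hr l ⟨hl.1, hl.2.trans i.lt_succ_self⟩)
      fun l hl => hskip l ⟨hl.1, hl.2.trans i.lt_succ_self⟩
    exact ⟨htrail.trans htrail', hk.trans hk'⟩

theorem IsRun.exists_backtrack_eq (hlt : IsDesiredTermOrdering lt) (hβ : TGround β)
    (h : IsRun lt N β ⊤ s r) {m : ℕ} (hgrow : ∀ i ≥ m, r i ≠ .grow) {f : ℕ → ℕ}
    (hf : ∀ i ≥ m, f (i + 1) ≤ f i) : ∃ i ≥ m, r i = .backtrack ∧ f (i + 1) = f i := by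
  have htop : ∀ i : ℕ, (i : ℕ∞) < ⊤ := ENat.natCast_lt_top
  by_contra! hback
  obtain ⟨i, hi⟩ := WellFounded.not_rel_apply_succ (r := (· < ·)) fun i =>
    toLex (f (m + i), (s (m + i)).measure hlt.wellFounded)
  have hmi : m + i ≥ m := Nat.le_add_right m i
  refine hi (Prod.Lex.toLex_lt_toLex.2 ?_)
  by_cases hr : r (m + i) = .backtrack
  · exact .inl ((hf _ hmi).lt_of_ne (hback _ hmi hr))
  · exact (hf _ hmi).lt_or_eq.imp_right fun heq => ⟨heq, (h.transition hlt (htop _)).measure_lt hlt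
      (h.inv hlt hβ le_top) hr (hgrow _ hmi)⟩

end Runs

section RegularRuns

variable {L : FirstOrder.Language.{u, v}} {V : Type w} {lt : L.Term V → L.Term V → Prop}
  {β : L.Term V} {N : Set (Clause L V)} {n : ℕ∞} {s : ℕ → State L V} {r : ℕ → Rule} {i : ℕ}

theorem IsRegularRun.not_applicable_conflict (h : IsRegularRun lt N β n s r) (hi : (i : ℕ∞) < n)
    (hr : r i = .propagate ∨ r i = .decide) : ¬ Applicable lt .conflict (s i) := by
  refine (h.precedence i hi ?_ ?_).1 <;> rcases hr with hr | hr <;> simp [hr]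

theorem IsRegularRun.prefixInv (hlt : IsDesiredTermOrdering lt) (hβ : TGround β)
    (h : IsRegularRun lt N β n s r) (hi : (i : ℕ∞) ≤ n) : (s i).PrefixInv lt := by
  induction i with
  | zero => simp [h.run.1, initialState, State.PrefixInv]
  | succ i ih =>
    have hin : (i : ℕ∞) < n := ENat.natCast_add_one_le_iff.1 (by exact_mod_cast hi)
    exact (h.run.transition hlt hin).prefixInv hlt (h.run.inv hlt hβ hin.le).ground
      (h.not_applicable_conflict hin) (ih hin.le)

theorem IsRegularRun.profile_notMem_of_skip (hlt : IsDesiredTermOrdering lt) (hβ : TGround β)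
    (h : IsRegularRun lt N β n s r) (hi : (i : ℕ∞) ≤ n)
    (hempty : ¬ HasFalseInstance lt (s i).β ((s i).N ∪ (s i).U) ∅)
    {C : Clause L V} {σ : Subst L V} (hC : (s i).status = .conflict C σ)
    {l : ℕ} (hli : l < i) (hl : r l = .skip) (hr : ∀ j ∈ Set.Ico l i, (r j).IsConflictRule) :
    Clause.profile (Clause.subst C σ) ∉ profiles lt (s i).β ((s i).N ∪ (s i).U) := by
  have hln : (l : ℕ∞) < n := (Nat.cast_lt.2 hli).trans_le hi
  obtain ⟨a, ha⟩ := (hl ▸ h.run.transition hlt hln).trail_append_of_skip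
  obtain ⟨-, -, htrail⟩ := h.run.of_isConflictRule hlt hi (Nat.succ_le_of_lt hli)
    fun j hj => hr j ⟨(Nat.le_succ l).trans hj.1, hj.2⟩
  obtain ⟨hβ', hU, -⟩ := h.run.of_isConflictRule hlt hi hli.le hr
  rw [hβ', hU] at hempty ⊢
  have hfalse := hβ' ▸ (h.run.inv hlt hβ hi).conflict_false C σ hC
  refine (hfalse.mono (Trail.lits_mono htrail.subset)).profile_notMem ?_
  exact h.prefixInv hlt hβ hln.le hempty _ a (ha ▸ List.prefix_rfl)

theorem IsRegularRun.profile_notMem_of_decide (hlt : IsDesiredTermOrdering lt) (hβ : TGround β)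
    (h : IsRegularRun lt N β n s r) (hi : (i : ℕ∞) ≤ n)
    {C : Clause L V} {K : Literal L V} {σ : Subst L V}
    (hC : (s i).status = .conflict (C + {K}) σ)
    (hlevel : clauseLevel (s i).trail (Clause.subst C σ) < (s i).k)
    (hcomp : ∃ Γ a, (s i).trail = Γ ++ [a] ∧ a.lit.comp ∈ Clause.subst (C + {K}) σ)
    {j : ℕ} (hji : j < i) (hj : r j = .decide)
    (hr : ∀ l ∈ Set.Ico (j + 1) i, (r l).IsConflictRule ∧ r l ≠ .skip) :
    Clause.profile (Clause.subst (C + {K}) σ) ∉ profiles lt (s i).β ((s i).N ∪ (s i).U) := by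
  have hjn : (j : ℕ∞) < n := (Nat.cast_lt.2 hji).trans_le hi
  obtain ⟨hβ', hU, -⟩ := h.run.of_isConflictRule hlt hi hji fun l hl => (hr l hl).1
  obtain ⟨htrail, hk⟩ := h.run.trail_eq_of_ne_skip hlt hi hji (fun l hl => (hr l hl).1)
    fun l hl => (hr l hl).2
  have hfalse := (h.run.inv hlt hβ hi).conflict_false _ σ hC
  obtain ⟨a, hstep⟩ : ∃ a, DecideStep lt (s j) (s (j + 1)) a := by
    have hstep := h.run.2 j hjn
    rwa [hj] at hstep
  obtain ⟨Γ, b, hΓ, hmem⟩ := hcomp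
  rw [hstep.eq] at htrail hk hβ' hU
  obtain ⟨-, rfl⟩ := List.append_singleton_inj.1 (hΓ.symm.trans htrail)
  have hsubst : Clause.subst (C + {K}) σ = Clause.subst C σ + {K.subst σ} := by
    simp [Clause.subst]
  rw [hsubst] at hfalse hmem ⊢
  rw [htrail, hk] at hlevel
  rw [htrail, hβ'] at hfalse
  rw [hβ', hU]
  exact hstep.profile_notMem hlt (h.run.inv hlt hβ hjn.le).ground
    (fun T c hc hmem => h.no_complement j hjn hj T c b hc hmem (by rw [hstep.eq]))
    hfalse hlevel hmem

theorem IsRegularRun.exists_profile_notMem (hlt : IsDesiredTermOrdering lt) (hβ : TGround β)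
    (h : IsRegularRun lt N β n s r) (hi : (i : ℕ∞) < n) (hr : r i = .backtrack)
    (hempty : ¬ HasFalseInstance lt (s i).β ((s i).N ∪ (s i).U) ∅) :
    ∃ p ∈ profiles lt (s (i + 1)).β ((s (i + 1)).N ∪ (s (i + 1)).U),
      p ∉ profiles lt (s i).β ((s i).N ∪ (s i).U) := by
  obtain ⟨Γ, Γ', a, D, K, σ, -, hD, hlevel, -, -, hT⟩ : BacktrackStep lt (s i) (s (i + 1)) := by
    have hstep := h.run.2 i hi
    rwa [hr] at hstep
  have hfalse := (h.run.inv hlt hβ hi.le).conflict_false _ _ hD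
  refine ⟨Clause.profile (Clause.subst (D + {K}) σ), ⟨D + {K}, by simp [hT], σ,
    fun H hH => hT ▸ (hfalse H hH).1, rfl⟩, ?_⟩
  obtain ⟨j, hji, hj, hlast, hrules⟩ := h.run.exists_last_conflict hlt hi.le hD
  by_cases hskip : ∃ l, j < l ∧ l < i ∧ r l = .skip
  · obtain ⟨l, hjl, hli, hl⟩ := hskip
    exact h.profile_notMem_of_skip hlt hβ hi.le hempty hD hli hl
      fun m hm => hrules m ⟨hjl.le.trans hm.1, hm.2⟩
  · have hdecide : 0 < j ∧ r (j - 1) = .decide := by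
      by_contra hnd
      exact hskip (h.skip_once i j hi hr hji hj hlast hnd)
    obtain ⟨Δ, b, E, τ, htrail, hE, H, hH, hcomp⟩ := h.after_decide i j hi hr hji hj hlast hdecide
    obtain ⟨rfl, rfl⟩ : D + {K} = E ∧ σ = τ := by simpa [hD] using hE
    refine h.profile_notMem_of_decide hlt hβ hi.le hD hlevel
      ⟨Δ, b, htrail, hcomp ▸ Multiset.mem_map_of_mem _ hH⟩ (j := j - 1) (by omega) hdecide.2 ?_
    rw [Nat.sub_add_cancel hdecide.1]
    refine fun l hl => ⟨hrules l hl, fun hl_skip => ?_⟩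
    rcases hl.1.eq_or_lt with rfl | hjl
    exacts [by simp [hj] at hl_skip, hskip ⟨l, hjl, hl.2, hl_skip⟩]

theorem IsRegularRun.not_hasFalseInstance_empty (hlt : IsDesiredTermOrdering lt)
    (hβ : TGround β) (h : IsRegularRun lt N β ⊤ s r) {m : ℕ} (hgrow : ∀ i ≥ m, r i ≠ .grow) :
    ¬ HasFalseInstance lt (s m).β ((s m).N ∪ (s m).U) ∅ := by
  intro hfalse
  have htop : ∀ i : ℕ, (i : ℕ∞) < ⊤ := ENat.natCast_lt_top
  have hpersist : ∀ i ≥ m, HasFalseInstance lt (s i).β ((s i).N ∪ (s i).U) ∅ := by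
    intro i hi
    induction i, hi using Nat.le_induction with
    | base => exact hfalse
    | succ i hi ih =>
      have hstep := h.run.transition hlt (htop i)
      exact (hstep.β_eq (hgrow i hi)) ▸ ih.mono hstep.clauses_subset le_rfl
  have hno (i) (hi : i ≥ m) (hr : r i = .propagate ∨ r i = .decide) : False :=
    h.not_applicable_conflict (htop i) hr <| ((hpersist i hi).mono subset_rfl
      (Set.empty_subset _)).applicable_conflict hlt (h.run.inv hlt hβ le_top).ground
        ((h.run.transition hlt (htop i)).status_eq_top hr)
  obtain ⟨i, _, hri, heq⟩ := h.run.exists_backtrack_eq hlt hβ hgrow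
    (f := fun i => List.length (s i).trail) fun i hi =>
      (h.run.transition hlt (htop i)).length_trail_le (fun hr => hno i hi (.inl hr))
        fun hr => hno i hi (.inr hr)
  exact (hri ▸ h.run.transition hlt (htop i)).length_trail_lt_of_backtrack.ne heq

theorem IsRegularRun.infinite_setOf_grow (hlt : IsDesiredTermOrdering lt) (hβ : TGround β)
    (h : IsRegularRun lt N β ⊤ s r) : {i | r i = .grow}.Infinite := by
  intro hfin
  obtain ⟨b, hb⟩ := hfin.bddAbove
  have hgrow : ∀ i ≥ b + 1, r i ≠ .grow := fun i hi hri =>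
    (Nat.lt_of_succ_le hi).not_ge (hb hri)
  have htop : ∀ i : ℕ, (i : ℕ∞) < ⊤ := ENat.natCast_lt_top
  have hfinite (i) : ((s i).missingProfiles lt).Finite :=
    State.finite_missingProfiles hlt (h.run.inv hlt hβ le_top).ground
  obtain ⟨i, hi, hri, heq⟩ := h.run.exists_backtrack_eq hlt hβ hgrow
    (f := fun i => ((s i).missingProfiles lt).ncard) fun i hi => Set.ncard_le_ncard
      ((h.run.transition hlt (htop i)).missingProfiles_subset (hgrow i hi)) (hfinite i)
  obtain ⟨p, hp, hpi⟩ := h.exists_profile_notMem hlt hβ (htop i) hri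
    (h.not_hasFalseInstance_empty hlt hβ fun j hj => hgrow j (hi.trans hj))
  have hstep := h.run.transition hlt (htop i)
  have hmem : p ∈ (s i).missingProfiles lt :=
    ⟨hstep.β_eq (hgrow i hi) ▸ profiles_subset _ hp, hpi⟩
  rw [← Set.eq_of_subset_of_ncard_le (hstep.missingProfiles_subset (hgrow i hi)) heq.ge
    (hfinite i)] at hmem
  exact hmem.2 hp

end RegularRuns

section Extension

variable {L : FirstOrder.Language.{u, v}} {V : Type w} {lt : L.Term V → L.Term V → Prop}
  {β : L.Term V} {N : Set (Clause L V)} {s s' : ℕ → State L V} {r r' : ℕ → Rule} {m : ℕ}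

theorem Transition.eq_of_status_eq_top {S T : State L V} {q : Rule} (h : Transition lt S q T)
    (hS : S.status = .top) : q = .propagate ∨ q = .decide ∨ q = .conflict ∨ q = .grow := by
  cases h with
  | extend _ a k hr => tauto
  | _ => simp_all

theorem IsRegularRun.congr (h : IsRegularRun lt N β m s r) (hs : ∀ i ≤ m, s' i = s i)
    (hr : ∀ i < m, r' i = r i) : IsRegularRun lt N β m s' r' where
  run := by
    refine ⟨(hs 0 m.zero_le).trans h.run.1, fun i hi => ?_⟩
    have him : i < m := Nat.cast_lt.1 hi
    rw [hs i him.le, hs (i + 1) him, hr i him]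
    exact h.run.2 i hi
  precedence i hi := by
    have him : i < m := Nat.cast_lt.1 hi
    rw [hs i him.le, hr i him]
    exact h.precedence i hi
  propagate_first i hi := by
    have him : i < m := Nat.cast_lt.1 hi
    rw [hs i him.le, hr i him]
    exact h.propagate_first i hi
  no_complement i hi := by
    have him : i < m := Nat.cast_lt.1 hi
    rw [hs i him.le, hs (i + 1) him, hr i him]
    exact h.no_complement i hi
  skip_once i j hi := by
    have him : i < m := Nat.cast_lt.1 hi
    have := h.skip_once i j hi
    grind
  after_decide i j hi := by
    have him : i < m := Nat.cast_lt.1 hi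
    have := h.after_decide i j hi
    grind

theorem IsRegularRun.succ (h : IsRegularRun lt N β m s r) (hm : Step lt (r m) (s m) (s (m + 1)))
    (hprec : r m ≠ .conflict → r m ≠ .factorize →
      ¬ Applicable lt .conflict (s m) ∧ ¬ Applicable lt .factorize (s m))
    (hprop : r m = .decide → ¬ Applicable lt .propagate (s m)) (hback : r m ≠ .backtrack) :
    IsRegularRun lt N β ((m + 1 : ℕ) : ℕ∞) s r := by
  have hlt_or_eq {i : ℕ} (hi : (i : ℕ∞) < ((m + 1 : ℕ) : ℕ∞)) : (i : ℕ∞) < m ∨ i = m :=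
    (Nat.lt_succ_iff_lt_or_eq.1 (Nat.cast_lt.1 hi)).imp_left Nat.cast_lt.2
  refine ⟨⟨h.run.1, fun i hi => ?_⟩, fun i hi => ?_, fun i hi => ?_, fun i hi => ?_,
    fun i j hi hri => ?_, fun i j hi hri => ?_⟩ <;> rcases hlt_or_eq hi with him | rfl
  · exact h.run.2 i him
  · exact hm
  · exact h.precedence i him
  · exact hprec
  · exact h.propagate_first i him
  · exact fun hri _ => hprop hri
  · exact h.no_complement i him
  · exact fun hri U a b ha => absurd ⟨U, a, ha⟩ (hprop hri)
  · exact h.skip_once i j him hri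
  · exact absurd hri hback
  · exact h.after_decide i j him hri
  · exact absurd hri hback

theorem IsRegularRun.exists_extension_of_step (h : IsRegularRun lt N β m s r) {q : Rule}
    {T : State L V} (hq : Step lt q (s m) T)
    (hprec : q ≠ .conflict → q ≠ .factorize →
      ¬ Applicable lt .conflict (s m) ∧ ¬ Applicable lt .factorize (s m))
    (hprop : q = .decide → ¬ Applicable lt .propagate (s m)) (hback : q ≠ .backtrack) :
    ∃ s' r', IsRegularRun lt N β ((m + 1 : ℕ) : ℕ∞) s' r' ∧ r' m = q ∧
      (∀ i ≤ m, s' i = s i) ∧ ∀ i < m, r' i = r i := by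
  classical
  let s' := Function.update s (m + 1) T
  let r' := Function.update r m q
  have hs (i) (hi : i ≤ m) : s' i = s i :=
    Function.update_of_ne (by omega : i ≠ m + 1) T s
  have hr (i) (hi : i < m) : r' i = r i := Function.update_of_ne hi.ne q r
  have hsT : s' (m + 1) = T := Function.update_self (m + 1) T s
  have hrq : r' m = q := Function.update_self m q r
  refine ⟨s', r', (h.congr hs hr).succ ?_ ?_ ?_ ?_, hrq, hs, hr⟩ <;>
    simpa only [hrq, hsT, hs m le_rfl]

theorem IsRegularRun.exists_extension (hlt : IsDesiredTermOrdering lt)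
    (h : IsRegularRun lt N β m s r) (hm : (s m).status = .top) {q : Rule} (hq : q ≠ .grow)
    (happ : Applicable lt q (s m)) :
    ∃ s' r', IsRegularRun lt N β ((m + 1 : ℕ) : ℕ∞) s' r' ∧ r' m ≠ .grow ∧
      (∀ i ≤ m, s' i = s i) ∧ ∀ i < m, r' i = r i := by
  suffices ∃ q T, Step lt q (s m) T ∧ q ≠ .grow ∧ q ≠ .backtrack ∧
      (q ≠ .conflict → ¬ Applicable lt .conflict (s m)) ∧
      (q = .decide → ¬ Applicable lt .propagate (s m)) by
    obtain ⟨q, T, hT, hgrow, hback, hconflict, hprop⟩ := this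
    have hfactorize : ¬ Applicable lt .factorize (s m) := fun ⟨U, hU⟩ => by
      simpa using (hU.transition hlt).eq_of_status_eq_top hm
    obtain ⟨s', r', h', rfl, hs, hr⟩ := h.exists_extension_of_step hT
      (fun hq _ => ⟨hconflict hq, hfactorize⟩) hprop hback
    exact ⟨s', r', h', hgrow, hs, hr⟩
  by_cases hconflict : Applicable lt .conflict (s m)
  · obtain ⟨T, hT⟩ := hconflict
    exact ⟨.conflict, T, hT, by simp⟩
  by_cases hprop : Applicable lt .propagate (s m)
  · obtain ⟨T, hT⟩ := hprop
    exact ⟨.propagate, T, hT, by simp [hconflict]⟩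
  obtain ⟨T, hT⟩ := happ
  have hdecide : q = .decide := by
    rcases (hT.transition hlt).eq_of_status_eq_top hm with rfl | rfl | rfl | rfl
    exacts [absurd ⟨T, hT⟩ hprop, rfl, absurd ⟨T, hT⟩ hconflict, absurd rfl hq]
  exact ⟨q, T, hT, hq, by simp [hdecide], fun _ => hconflict, fun _ => hprop⟩

end Extension

end SCLEQ

theorem mainTheorem4_general {L : FirstOrder.Language.{u, v}} {V : Type w}
    (lt : L.Term V → L.Term V → Prop) (hlt : SCLEQ.IsDesiredTermOrdering lt)
    (N : Set (SCLEQ.Clause L V)) (β : L.Term V) (hβ : SCLEQ.TGround β)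
    (n : ℕ∞) (s : ℕ → SCLEQ.State L V) (r : ℕ → SCLEQ.Rule)
    (hrun : SCLEQ.IsRegularRun lt N β n s r) :
    ({i : ℕ | (i : ℕ∞) < n ∧ r i = SCLEQ.Rule.grow}.Finite → n ≠ ⊤) ∧
    (∀ m : ℕ, n = m → (s m).status = SCLEQ.Status.top →
      (¬ ∃ (s' : ℕ → SCLEQ.State L V) (r' : ℕ → SCLEQ.Rule),
        SCLEQ.IsRegularRun lt N β ((m + 1 : ℕ) : ℕ∞) s' r' ∧ r' m ≠ SCLEQ.Rule.grow ∧
        (∀ i ≤ m, s' i = s i) ∧ (∀ i < m, r' i = r i)) →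
      ∀ q : SCLEQ.Rule, q ≠ SCLEQ.Rule.grow → ¬ SCLEQ.Applicable lt q (s m)) := by
  refine ⟨?_, ?_⟩
  · rintro hfinite rfl
    exact hrun.infinite_setOf_grow hlt hβ (by simpa using hfinite)
  · rintro m rfl hm hmaximal q hq happ
    exact hmaximal (hrun.exists_extension hlt hm hq happ)

theorem mainTheorem4 {L : FirstOrder.Language.{u, v}} {V : Type w} [Infinite V]
    (lt : L.Term V → L.Term V → Prop) (hlt : SCLEQ.IsDesiredTermOrdering lt)
    (N : Set (SCLEQ.Clause L V)) (β : L.Term V) (hβ : SCLEQ.TGround β)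
    (n : ℕ∞) (s : ℕ → SCLEQ.State L V) (r : ℕ → SCLEQ.Rule)
    (hrun : SCLEQ.IsRegularRun lt N β n s r)
    (hgrow : ∀ i : ℕ, (i : ℕ∞) < n → r i ≠ SCLEQ.Rule.grow) :
    -- the run is finite
    n ≠ ⊤ ∧
    -- if it ends with status `⊤` and has no regular continuation, no rule but Grow is applicable
    (∀ m : ℕ, n = m → (s m).status = SCLEQ.Status.top →
      (¬ ∃ (s' : ℕ → SCLEQ.State L V) (r' : ℕ → SCLEQ.Rule),
        SCLEQ.IsRegularRun lt N β ((m + 1 : ℕ) : ℕ∞) s' r' ∧ r' m ≠ SCLEQ.Rule.grow ∧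
        (∀ i ≤ m, s' i = s i) ∧ (∀ i < m, r' i = r i)) →
      ∀ q : SCLEQ.Rule, q ≠ SCLEQ.Rule.grow → ¬ SCLEQ.Applicable lt q (s m)) :=
  (mainTheorem4_general lt hlt N β hβ n s r hrun).imp_left fun hfinite =>
    hfinite (Set.finite_empty.subset fun i hi => hgrow i hi.1 hi.2)
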